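/- Let $M$ be a smooth manifold of dimension $2n+1$ and let $\varepsilon_0,\varepsilon_1\in\{1,-1\}$. Let $(\varphi,\xi,\eta,g)$ be an almost (para)contact metric structure on $M$, that is, a smooth $(1,1)$-tensor field $\varphi$, a smooth vector field $\xi$, a smooth 1-form $\eta$ and a smooth Riemannian or pseudo-Riemannian metric $g$ such that $$\varphi^2X=\varepsilon_1(X-\eta(X)\xi),\qquad \eta(\xi)=1,\qquad g(\varphi X,\varphi Y)=-\varepsilon_1\bigl(g(X,Y)-\varepsilon_0\,\eta(X)\eta(Y)\bigr)$$ for all vector fields $X,Y$. Let $\Phi(X,Y)=g(X,\varphi Y)$ and suppose that the structure is (para)contact metric, i.e. $d\eta=\Phi$, where $d\eta(X,Y)=\tfrac12\bigl(X(\eta(Y))-Y(\eta(X))-\eta([X,Y])\bigr)$. Let $\nabla$ be the Levi-Civita connection of $g$, $R(X,Y)=[\nabla_X,\nabla_Y]-\nabla_{[X,Y]}$ and $R(X,Y,Z,W)=g(R(X,Y)Z,W)$. Then, for all vector fields $X,Y,Z,W$ and every orthonormal frame $(E_i)_{1\le i\le 2n+1}$ with $\epsilon_i=g(E_i,E_i)=\pm1$,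 $$\begin{aligned} &R(Z,\varphi X,\varphi Y,W)+R(Z,\varphi X,Y,\varphi W)+R(\varphi Z,X,\varphi Y,W)+R(\varphi Z,X,Y,\varphi W)\\ &\quad-R(\varphi Z,\varphi X,Y,W)-\varepsilon_1R(\varphi Z,\varphi X,\varphi Y,\varphi W)-\varepsilon_1R(Z,X,Y,W)-R(Z,X,\varphi Y,\varphi W)\\ &=-2\sum_{i=1}^{2n+1}\epsilon_i(\nabla_{E_i}\Phi)(Z,X)\,(\nabla_{E_i}\Phi)(W,Y)\\ &\quad+2\varepsilon_0\varepsilon_1(\nabla_Z\Phi)(W,Y)\,\eta(X)-2\varepsilon_0\varepsilon_1(\nabla_X\Phi)(W,Y)\,\eta(Z)\\ &\quad-2\varepsilon_0\varepsilon_1(\nabla_Y\Phi)(Z,X)\,\eta(W)+2\varepsilon_0\varepsilon_1(\nabla_W\Phi)(Z,X)\,\eta(Y)\\ &\quad+4\varepsilon_0\,g(\varphi X,\varphi Y)\,g(\varphi Z,\varphi W)-4\varepsilon_0\,g(\varphi Z,\varphi Y)\,g(\varphi X,\varphi W)\\ &\quad+4\varepsilon_0\varepsilon_1\,g(Y,\varphi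 X)\,g(\varphi Z,W)-4\varepsilon_0\varepsilon_1\,g(Y,\varphi Z)\,g(\varphi X,W). \end{aligned}$$ -/

import Mathlib

open Bundle VectorField
open scoped Manifold ContDiff

noncomputable section

/-- A smooth pseudo-Riemannian metric on the manifold `M` modelled on `E`: a smooth field of
nondegenerate symmetric bilinear forms on the tangent spaces. -/
structure PseudoRiemannianMetric (E : Type*) [NormedAddCommGroup E] [NormedSpace ℝ E]
    (M : Type*) [TopologicalSpace M] [ChartedSpace E M] [IsManifold 𝓘(ℝ, E) ∞ M] where
  inner (x : M) : TangentSpace 𝓘(ℝ, E) x →L[ℝ] TangentSpace 𝓘(ℝ, E) x →L[ℝ] ℝ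
  symm (x : M) (v w : TangentSpace 𝓘(ℝ, E) x) : inner x v w = inner x w v
  nondegenerate (x : M) (v : TangentSpace 𝓘(ℝ, E) x) (hv : ∀ w, inner x v w = 0) : v = 0
  contMDiff : ContMDiff 𝓘(ℝ, E) (𝓘(ℝ, E).prod 𝓘(ℝ, E →L[ℝ] E →L[ℝ] ℝ)) ∞
    (fun x ↦ TotalSpace.mk' (E →L[ℝ] E →L[ℝ] ℝ) x (inner x))

namespace PseudoRiemannianMetric

variable {E : Type*} [NormedAddCommGroup E] [NormedSpace ℝ E]
  {M : Type*} [TopologicalSpace M] [ChartedSpace E M] [IsManifold 𝓘(ℝ, E) ∞ M]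
  (g : PseudoRiemannianMetric E M)

/-- The right-hand side of the Koszul formula for `2 g(∇_X Y, Z)`, at the point `x`. -/
def koszul (X Y Z : Π x : M, TangentSpace 𝓘(ℝ, E) x) (x : M) : ℝ :=
  mvfderiv 𝓘(ℝ, E) (fun y ↦ g.inner y (Y y) (Z y)) x (X x)
    + mvfderiv 𝓘(ℝ, E) (fun y ↦ g.inner y (Z y) (X y)) x (Y x)
    - mvfderiv 𝓘(ℝ, E) (fun y ↦ g.inner y (X y) (Y y)) x (Z x)
    + g.inner x (mlieBracket 𝓘(ℝ, E) X Y x) (Z x)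
    - g.inner x (mlieBracket 𝓘(ℝ, E) Y Z x) (X x)
    + g.inner x (mlieBracket 𝓘(ℝ, E) Z X x) (Y x)

theorem mdifferentiableAt_inner {X Y : Π x : M, TangentSpace 𝓘(ℝ, E) x} {x : M}
    (hX : MDiffAt (T% X) x) (hY : MDiffAt (T% Y) x) :
    MDiffAt (fun y ↦ g.inner y (X y) (Y y)) x := by
  have : MDifferentiableAt 𝓘(ℝ, E) (𝓘(ℝ, E).prod 𝓘(ℝ))
      (fun m ↦ TotalSpace.mk' ℝ (E := Bundle.Trivial M ℝ) m (g.inner m (X m) (Y m))) x := by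
    apply MDifferentiableAt.clm_bundle_apply₂ (F₁ := E) (F₂ := E)
    · exact g.contMDiff.mdifferentiableAt (by simp)
    · exact hX
    · exact hY
  simp only [mdifferentiableAt_totalSpace] at this
  exact this.2

theorem mvfderiv_inner_smul_left {X Y : Π x : M, TangentSpace 𝓘(ℝ, E) x} {f : M → ℝ} {x : M}
    (hf : MDiffAt f x) (hX : MDiffAt (T% X) x) (hY : MDiffAt (T% Y) x)
    (v : TangentSpace 𝓘(ℝ, E) x) :
    mvfderiv 𝓘(ℝ, E) (fun y ↦ g.inner y ((f • X) y) (Y y)) x v =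
      f x * mvfderiv 𝓘(ℝ, E) (fun y ↦ g.inner y (X y) (Y y)) x v
        + mvfderiv 𝓘(ℝ, E) f x v * g.inner x (X x) (Y x) := by
  have h : (fun y ↦ g.inner y ((f • X) y) (Y y)) = f * (fun y ↦ g.inner y (X y) (Y y)) := by
    ext y; simp
  rw [h, mvfderiv_mul hf (g.mdifferentiableAt_inner hX hY)]
  simp; ring

theorem mvfderiv_inner_smul_right {X Y : Π x : M, TangentSpace 𝓘(ℝ, E) x} {f : M → ℝ} {x : M}
    (hf : MDiffAt f x) (hX : MDiffAt (T% X) x) (hY : MDiffAt (T% Y) x)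
    (v : TangentSpace 𝓘(ℝ, E) x) :
    mvfderiv 𝓘(ℝ, E) (fun y ↦ g.inner y (X y) ((f • Y) y)) x v =
      f x * mvfderiv 𝓘(ℝ, E) (fun y ↦ g.inner y (X y) (Y y)) x v
        + mvfderiv 𝓘(ℝ, E) f x v * g.inner x (X x) (Y x) := by
  have h : (fun y ↦ g.inner y (X y) ((f • Y) y)) = f * (fun y ↦ g.inner y (X y) (Y y)) := by
    ext y; simp
  rw [h, mvfderiv_mul hf (g.mdifferentiableAt_inner hX hY)]
  simp; ring

theorem mvfderiv_inner_add_left {X X' Y : Π x : M, TangentSpace 𝓘(ℝ, E) x} {x : M}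
    (hX : MDiffAt (T% X) x) (hX' : MDiffAt (T% X') x) (hY : MDiffAt (T% Y) x)
    (v : TangentSpace 𝓘(ℝ, E) x) :
    mvfderiv 𝓘(ℝ, E) (fun y ↦ g.inner y ((X + X') y) (Y y)) x v =
      mvfderiv 𝓘(ℝ, E) (fun y ↦ g.inner y (X y) (Y y)) x v
        + mvfderiv 𝓘(ℝ, E) (fun y ↦ g.inner y (X' y) (Y y)) x v := by
  have h : (fun y ↦ g.inner y ((X + X') y) (Y y)) =
      (fun y ↦ g.inner y (X y) (Y y)) + (fun y ↦ g.inner y (X' y) (Y y)) := by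
    ext y; simp
  rw [h, mvfderiv_add (g.mdifferentiableAt_inner hX hY) (g.mdifferentiableAt_inner hX' hY)]
  simp

theorem mvfderiv_inner_add_right {X Y Y' : Π x : M, TangentSpace 𝓘(ℝ, E) x} {x : M}
    (hX : MDiffAt (T% X) x) (hY : MDiffAt (T% Y) x) (hY' : MDiffAt (T% Y') x)
    (v : TangentSpace 𝓘(ℝ, E) x) :
    mvfderiv 𝓘(ℝ, E) (fun y ↦ g.inner y (X y) ((Y + Y') y)) x v =
      mvfderiv 𝓘(ℝ, E) (fun y ↦ g.inner y (X y) (Y y)) x v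
        + mvfderiv 𝓘(ℝ, E) (fun y ↦ g.inner y (X y) (Y' y)) x v := by
  have h : (fun y ↦ g.inner y (X y) ((Y + Y') y)) =
      (fun y ↦ g.inner y (X y) (Y y)) + (fun y ↦ g.inner y (X y) (Y' y)) := by
    ext y; simp
  rw [h, mvfderiv_add (g.mdifferentiableAt_inner hX hY) (g.mdifferentiableAt_inner hX hY')]
  simp

theorem eq_of_inner_eq {x : M} {v v' : TangentSpace 𝓘(ℝ, E) x}
    (h : ∀ Z : Π x : M, TangentSpace 𝓘(ℝ, E) x, MDiffAt (T% Z) x →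
      2 * g.inner x v (Z x) = 2 * g.inner x v' (Z x)) : v = v' := by
  rw [← sub_eq_zero]
  refine g.nondegenerate x _ fun w ↦ ?_
  have := h (FiberBundle.extend E w) (FiberBundle.mdifferentiableAt_extend ..)
  simp only [FiberBundle.extend_apply_self] at this
  simp only [map_sub, _root_.sub_apply]
  linarith

variable [FiniteDimensional ℝ E]

theorem koszul_add_middle {X Y Y' Z : Π x : M, TangentSpace 𝓘(ℝ, E) x} {x : M}
    (hX : MDiffAt (T% X) x) (hY : MDiffAt (T% Y) x) (hY' : MDiffAt (T% Y') x)
    (hZ : MDiffAt (T% Z) x) :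
    g.koszul X (Y + Y') Z x = g.koszul X Y Z x + g.koszul X Y' Z x := by
  have : IsManifold 𝓘(ℝ, E) 2 M := IsManifold.of_le (n := ∞) (by norm_cast)
  have : CompleteSpace E := FiniteDimensional.complete ℝ E
  simp only [koszul]
  rw [g.mvfderiv_inner_add_left hY hY' hZ, g.mvfderiv_inner_add_right hX hY hY',
    mlieBracket_add_right hY hY', mlieBracket_add_left hY hY']
  simp; ring

theorem koszul_smul_middle {X Y Z : Π x : M, TangentSpace 𝓘(ℝ, E) x} {f : M → ℝ} {x : M}
    (hf : MDiffAt f x)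
    (hX : MDiffAt (T% X) x) (hY : MDiffAt (T% Y) x) (hZ : MDiffAt (T% Z) x) :
    g.koszul X (f • Y) Z x = f x * g.koszul X Y Z x
      + 2 * (mvfderiv 𝓘(ℝ, E) f x (X x) * g.inner x (Y x) (Z x)) := by
  have : IsManifold 𝓘(ℝ, E) 2 M := IsManifold.of_le (n := ∞) (by norm_cast)
  have : CompleteSpace E := FiniteDimensional.complete ℝ E
  simp only [koszul]
  rw [g.mvfderiv_inner_smul_left hf hY hZ, g.mvfderiv_inner_smul_right hf hX hY,
    mlieBracket_smul_right hf hY, mlieBracket_smul_left hf hY]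
  simp [g.symm x (X x) (Y x)]; ring

theorem tensorialAt_koszul_left (Y Z : Π x : M, TangentSpace 𝓘(ℝ, E) x) {x : M}
    (hY : MDiffAt (T% Y) x) (hZ : MDiffAt (T% Z) x) :
    TensorialAt 𝓘(ℝ, E) E (fun X ↦ g.koszul X Y Z x) x := by
  have : IsManifold 𝓘(ℝ, E) 2 M := IsManifold.of_le (n := ∞) (by norm_cast)
  have : CompleteSpace E := FiniteDimensional.complete ℝ E
  constructor
  · intro f X hf hX
    simp only [koszul]
    rw [g.mvfderiv_inner_smul_left hf hX hY, g.mvfderiv_inner_smul_right hf hZ hX,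
      mlieBracket_smul_right hf hX, mlieBracket_smul_left hf hX]
    simp [g.symm x (Z x) (X x)]; ring
  · intro X X' hX hX'
    simp only [koszul]
    rw [g.mvfderiv_inner_add_left hX hX' hY, g.mvfderiv_inner_add_right hZ hX hX',
      mlieBracket_add_right hX hX', mlieBracket_add_left hX hX']
    simp; ring

theorem tensorialAt_koszul_right (X Y : Π x : M, TangentSpace 𝓘(ℝ, E) x) {x : M}
    (hX : MDiffAt (T% X) x) (hY : MDiffAt (T% Y) x) :
    TensorialAt 𝓘(ℝ, E) E (fun Z ↦ g.koszul X Y Z x) x := by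
  have : IsManifold 𝓘(ℝ, E) 2 M := IsManifold.of_le (n := ∞) (by norm_cast)
  have : CompleteSpace E := FiniteDimensional.complete ℝ E
  constructor
  · intro f Z hf hZ
    simp only [koszul]
    rw [g.mvfderiv_inner_smul_left hf hZ hX, g.mvfderiv_inner_smul_right hf hY hZ,
      mlieBracket_smul_right hf hZ, mlieBracket_smul_left hf hZ]
    simp [g.symm x (Y x) (Z x)]; ring
  · intro Z Z' hZ hZ'
    simp only [koszul]
    rw [g.mvfderiv_inner_add_left hZ hZ' hX, g.mvfderiv_inner_add_right hY hZ hZ',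
      mlieBracket_add_right hZ hZ', mlieBracket_add_left hZ hZ']
    simp; ring

/-- For a vector field `Y` differentiable at `x`, the bilinear form `(u, w) ↦ 2 g(∇_u Y, w)` on the
tangent space at `x` that the Koszul formula determines. -/
def koszulForm (Y : Π x : M, TangentSpace 𝓘(ℝ, E) x) (x : M) (hY : MDiffAt (T% Y) x) :
    TangentSpace 𝓘(ℝ, E) x →L[ℝ] TangentSpace 𝓘(ℝ, E) x →L[ℝ] ℝ :=
  TensorialAt.mkHom₂ (I := 𝓘(ℝ, E)) (F := E) (F' := E) (fun X Z ↦ g.koszul X Y Z x) x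
    (fun Z hZ ↦ g.tensorialAt_koszul_left Y Z hY hZ)
    (fun X hX ↦ g.tensorialAt_koszul_right X Y hX hY)

theorem koszulForm_apply {X Y Z : Π x : M, TangentSpace 𝓘(ℝ, E) x} {x : M}
    (hX : MDiffAt (T% X) x) (hY : MDiffAt (T% Y) x) (hZ : MDiffAt (T% Z) x) :
    g.koszulForm Y x hY (X x) (Z x) = g.koszul X Y Z x :=
  TensorialAt.mkHom₂_apply _ _ hX hZ

/-- The isomorphism `v ↦ g(v, ·)` from the tangent space at `x` to its dual. -/
def flat (x : M) :
    TangentSpace 𝓘(ℝ, E) x ≃ₗ[ℝ] (TangentSpace 𝓘(ℝ, E) x →L[ℝ] ℝ) :=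
  haveI : FiniteDimensional ℝ (TangentSpace 𝓘(ℝ, E) x) := inferInstanceAs (FiniteDimensional ℝ E)
  haveI : T2Space (TangentSpace 𝓘(ℝ, E) x) := inferInstanceAs (T2Space E)
  LinearMap.linearEquivOfInjective (g.inner x).toLinearMap
    ((injective_iff_map_eq_zero _).2 fun v hv ↦ g.nondegenerate x v fun w ↦ by
      simpa using congrArg (fun f : TangentSpace 𝓘(ℝ, E) x →L[ℝ] ℝ ↦ f w) hv)
    (Subspace.dual_finrank_eq.symm.trans (LinearMap.toContinuousLinearMap (𝕜 := ℝ)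
      (E := TangentSpace 𝓘(ℝ, E) x) (F' := ℝ)).finrank_eq)

theorem flat_apply (x : M) (v w : TangentSpace 𝓘(ℝ, E) x) : g.flat x v w = g.inner x v w := rfl

open Classical in
/-- The underlying function of the Levi-Civita connection, `leviCivitaFun Y x u = ∇_u Y`: the
vector at `x` with `2 g(∇_u Y, w)` given by the Koszul formula. -/
def leviCivitaFun (Y : Π x : M, TangentSpace 𝓘(ℝ, E) x) (x : M) :
    TangentSpace 𝓘(ℝ, E) x →L[ℝ] TangentSpace 𝓘(ℝ, E) x :=
  haveI : FiniteDimensional ℝ (TangentSpace 𝓘(ℝ, E) x) := inferInstanceAs (FiniteDimensional ℝ E)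
  haveI : T2Space (TangentSpace 𝓘(ℝ, E) x) := inferInstanceAs (T2Space E)
  if hY : MDiffAt (T% Y) x then
    LinearMap.toContinuousLinearMap
      ((g.flat x).symm.toLinearMap ∘ₗ ((1 / 2 : ℝ) • g.koszulForm Y x hY).toLinearMap)
  else 0

theorem inner_leviCivitaFun {X Y Z : Π x : M, TangentSpace 𝓘(ℝ, E) x} {x : M}
    (hX : MDiffAt (T% X) x) (hY : MDiffAt (T% Y) x) (hZ : MDiffAt (T% Z) x) :
    2 * g.inner x (g.leviCivitaFun Y x (X x)) (Z x) = g.koszul X Y Z x := by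
  rw [← g.koszulForm_apply hX hY hZ, leviCivitaFun, dif_pos hY, ← flat_apply]
  simp

/-- The Levi-Civita connection of a pseudo-Riemannian metric; `g.leviCivita Y x (X x)` is
`(∇_X Y)(x)`. -/
def leviCivita : CovariantDerivative 𝓘(ℝ, E) E (TangentSpace 𝓘(ℝ, E) : M → Type _) where
  toFun := g.leviCivitaFun
  isCovariantDerivativeOnUniv := by
    constructor
    · intro Y Y' x hY hY' _
      ext u
      obtain ⟨X, hX, rfl⟩ : ∃ X : Π x : M, TangentSpace 𝓘(ℝ, E) x, MDiffAt (T% X) x ∧ X x = u :=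
        ⟨FiberBundle.extend E u, FiberBundle.mdifferentiableAt_extend .., by simp⟩
      refine g.eq_of_inner_eq fun Z hZ ↦ ?_
      rw [g.inner_leviCivitaFun hX (mdifferentiableAt_add_section hY hY') hZ,
        g.koszul_add_middle hX hY hY' hZ, ← g.inner_leviCivitaFun hX hY hZ,
        ← g.inner_leviCivitaFun hX hY' hZ]
      simp; ring
    · intro Y f x hY hf _
      ext u
      obtain ⟨X, hX, rfl⟩ : ∃ X : Π x : M, TangentSpace 𝓘(ℝ, E) x, MDiffAt (T% X) x ∧ X x = u :=
        ⟨FiberBundle.extend E u, FiberBundle.mdifferentiableAt_extend .., by simp⟩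
      refine g.eq_of_inner_eq fun Z hZ ↦ ?_
      rw [g.inner_leviCivitaFun hX (hf.smul_section hY) hZ,
        g.koszul_smul_middle hf hX hY hZ, ← g.inner_leviCivitaFun hX hY hZ]
      simp; ring

/-- The Levi-Civita connection is torsion-free. -/
theorem leviCivita_sub_swap {X Y : Π x : M, TangentSpace 𝓘(ℝ, E) x} {x : M}
    (hX : MDiffAt (T% X) x) (hY : MDiffAt (T% Y) x) :
    g.leviCivita Y x (X x) - g.leviCivita X x (Y x) = mlieBracket 𝓘(ℝ, E) X Y x := by
  refine g.eq_of_inner_eq fun Z hZ ↦ ?_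
  have h₁ := g.inner_leviCivitaFun hX hY hZ
  have h₂ := g.inner_leviCivitaFun hY hX hZ
  have e₁ : (fun y ↦ g.inner y (Y y) (X y)) = fun y ↦ g.inner y (X y) (Y y) := by
    ext y; exact g.symm ..
  have e₂ : (fun y ↦ g.inner y (X y) (Z y)) = fun y ↦ g.inner y (Z y) (X y) := by
    ext y; exact g.symm ..
  have e₃ : (fun y ↦ g.inner y (Z y) (Y y)) = fun y ↦ g.inner y (Y y) (Z y) := by
    ext y; exact g.symm ..
  simp only [koszul, e₁, e₂, e₃] at h₁ h₂
  rw [mlieBracket_swap_apply (V := Y) (W := X), mlieBracket_swap_apply (V := X) (W := Z),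
    mlieBracket_swap_apply (V := Z) (W := Y)] at h₂
  simp only [map_neg, _root_.neg_apply] at h₂
  simp only [map_sub, _root_.sub_apply, leviCivita]
  linarith

/-- The Levi-Civita connection is compatible with the metric. -/
theorem mvfderiv_inner_eq {X Y Z : Π x : M, TangentSpace 𝓘(ℝ, E) x} {x : M}
    (hX : MDiffAt (T% X) x) (hY : MDiffAt (T% Y) x) (hZ : MDiffAt (T% Z) x) :
    mvfderiv 𝓘(ℝ, E) (fun y ↦ g.inner y (Y y) (Z y)) x (X x) =
      g.inner x (g.leviCivita Y x (X x)) (Z x) + g.inner x (Y x) (g.leviCivita Z x (X x)) := by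
  have h₁ := g.inner_leviCivitaFun hX hY hZ
  have h₂ := g.inner_leviCivitaFun hX hZ hY
  have e₁ : (fun y ↦ g.inner y (Y y) (X y)) = fun y ↦ g.inner y (X y) (Y y) := by
    ext y; exact g.symm ..
  have e₂ : (fun y ↦ g.inner y (X y) (Z y)) = fun y ↦ g.inner y (Z y) (X y) := by
    ext y; exact g.symm ..
  have e₃ : (fun y ↦ g.inner y (Z y) (Y y)) = fun y ↦ g.inner y (Y y) (Z y) := by
    ext y; exact g.symm ..
  simp only [koszul, e₁, e₂, e₃] at h₁ h₂
  rw [mlieBracket_swap_apply (V := X) (W := Z), mlieBracket_swap_apply (V := Z) (W := Y),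
    mlieBracket_swap_apply (V := Y) (W := X)] at h₂
  simp only [map_neg, _root_.neg_apply] at h₂
  rw [g.symm x (Y x)]
  simp only [leviCivita]
  linarith

/-- The curvature operator `R(X, Y) Z = ∇_X ∇_Y Z - ∇_Y ∇_X Z - ∇_[X, Y] Z`. -/
def curvature (X Y Z : Π x : M, TangentSpace 𝓘(ℝ, E) x) (x : M) : TangentSpace 𝓘(ℝ, E) x :=
  g.leviCivita (fun y ↦ g.leviCivita Z y (Y y)) x (X x)
    - g.leviCivita (fun y ↦ g.leviCivita Z y (X y)) x (Y x)
    - g.leviCivita Z x (mlieBracket 𝓘(ℝ, E) X Y x)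

/-- The Riemann curvature tensor `R(X, Y, Z, W) = g(R(X, Y) Z, W)`. -/
def riemann (X Y Z W : Π x : M, TangentSpace 𝓘(ℝ, E) x) (x : M) : ℝ :=
  g.inner x (g.curvature X Y Z x) (W x)

end PseudoRiemannianMetric

/-- An almost (para)contact metric structure `(φ, ξ, η, g)` with signs `ε₀`, `ε₁` on `M`. -/
structure AlmostParaContactMetricStructure (ε₀ ε₁ : ℝ)
    (E : Type*) [NormedAddCommGroup E] [NormedSpace ℝ E]
    (M : Type*) [TopologicalSpace M] [ChartedSpace E M] [IsManifold 𝓘(ℝ, E) ∞ M] where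
  φ (x : M) : TangentSpace 𝓘(ℝ, E) x →L[ℝ] TangentSpace 𝓘(ℝ, E) x
  ξ (x : M) : TangentSpace 𝓘(ℝ, E) x
  η (x : M) : TangentSpace 𝓘(ℝ, E) x →L[ℝ] ℝ
  g : PseudoRiemannianMetric E M
  contMDiff_φ : ContMDiff 𝓘(ℝ, E) (𝓘(ℝ, E).prod 𝓘(ℝ, E →L[ℝ] E)) ∞
    (fun x ↦ TotalSpace.mk' (E →L[ℝ] E)
      (E := fun x : M ↦ TangentSpace 𝓘(ℝ, E) x →L[ℝ] TangentSpace 𝓘(ℝ, E) x) x (φ x))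
  contMDiff_ξ : ContMDiff 𝓘(ℝ, E) (𝓘(ℝ, E).prod 𝓘(ℝ, E)) ∞
    (fun x ↦ TotalSpace.mk' E (E := (TangentSpace 𝓘(ℝ, E) : M → Type _)) x (ξ x))
  contMDiff_η : ContMDiff 𝓘(ℝ, E) (𝓘(ℝ, E).prod 𝓘(ℝ, E →L[ℝ] ℝ)) ∞
    (fun x ↦ TotalSpace.mk' (E →L[ℝ] ℝ)
      (E := fun x : M ↦ TangentSpace 𝓘(ℝ, E) x →L[ℝ] Bundle.Trivial M ℝ x) x (η x))
  φ_φ (x : M) (v : TangentSpace 𝓘(ℝ, E) x) : φ x (φ x v) = ε₁ • (v - η x v • ξ x)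
  η_ξ (x : M) : η x (ξ x) = 1
  inner_φ_φ (x : M) (v w : TangentSpace 𝓘(ℝ, E) x) :
    g.inner x (φ x v) (φ x w) = -ε₁ * (g.inner x v w - ε₀ * (η x v * η x w))

namespace AlmostParaContactMetricStructure

variable {ε₀ ε₁ : ℝ} {E : Type*} [NormedAddCommGroup E] [NormedSpace ℝ E]
  {M : Type*} [TopologicalSpace M] [ChartedSpace E M] [IsManifold 𝓘(ℝ, E) ∞ M]
  (S : AlmostParaContactMetricStructure ε₀ ε₁ E M)

/-- The vector field `φX`. -/
def φField (X : Π x : M, TangentSpace 𝓘(ℝ, E) x) (x : M) : TangentSpace 𝓘(ℝ, E) x :=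
  S.φ x (X x)

/-- The fundamental form `Φ(X, Y) = g(X, φY)`. -/
def Φ (x : M) (v w : TangentSpace 𝓘(ℝ, E) x) : ℝ := S.g.inner x v (S.φ x w)

/-- The exterior derivative of `η`, normalized by
`dη(X, Y) = ½ (X(η(Y)) - Y(η(X)) - η([X, Y]))`. -/
def dη (X Y : Π x : M, TangentSpace 𝓘(ℝ, E) x) (x : M) : ℝ :=
  1 / 2 * (mvfderiv 𝓘(ℝ, E) (fun y ↦ S.η y (Y y)) x (X x)
    - mvfderiv 𝓘(ℝ, E) (fun y ↦ S.η y (X y)) x (Y x)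
    - S.η x (mlieBracket 𝓘(ℝ, E) X Y x))

/-- The structure is a (para)contact metric structure: `dη = Φ`. -/
def IsParaContact : Prop :=
  ∀ (x : M) (X Y : Π x : M, TangentSpace 𝓘(ℝ, E) x),
    ContMDiffAt 𝓘(ℝ, E) (𝓘(ℝ, E).prod 𝓘(ℝ, E)) ∞ (fun y ↦ TotalSpace.mk' E y (X y)) x →
    ContMDiffAt 𝓘(ℝ, E) (𝓘(ℝ, E).prod 𝓘(ℝ, E)) ∞ (fun y ↦ TotalSpace.mk' E y (Y y)) x →
    S.dη X Y x = S.Φ x (X x) (Y x)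

variable [FiniteDimensional ℝ E]

/-- The covariant derivative `(∇_v Φ)(Y, Z) = v(Φ(Y, Z)) - Φ(∇_v Y, Z) - Φ(Y, ∇_v Z)` of the
fundamental form in the direction of a tangent vector `v` at `x`. -/
def covΦ (x : M) (v : TangentSpace 𝓘(ℝ, E) x) (Y Z : Π x : M, TangentSpace 𝓘(ℝ, E) x) : ℝ :=
  mvfderiv 𝓘(ℝ, E) (fun y ↦ S.Φ y (Y y) (Z y)) x v
    - S.Φ x (S.g.leviCivita Y x v) (Z x) - S.Φ x (Y x) (S.g.leviCivita Z x v)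

end AlmostParaContactMetricStructure

end

/-! The identity is a Ricci identity combined with the fact that ∇φ almost commutes with φ. Applying
[R(U,V), φ] = ∇²_{U,V}φ - ∇²_{V,U}φ to suitable pairs of the eight curvature terms turns the
left-hand side into second covariant derivatives of φ, plus η(W) times terms R(·,·,Y,ξ), which the
Ricci identity for η turns into second derivatives of η.

The contact condition is used to remove all second derivatives. It makes 2Φ the antisymmetrization
of ∇η (`covη_sub_swap`), hence Φ closed (`covΦTensor_cyclic`). Closedness at (φu, v, w) and at (φu,
φv, φw), together with the derivative of φ² = ε₁(I - η⊗ξ), gives `covΦTensor_φ_left`: up to terms in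
η and ξ, (∇_{φu}Φ)(v,w) = (∇_uΦ)(v,φw). Differentiating this identity and its consequences relates
∇²_{U,φV}φ to ∇²_{U,V}φ∘φ modulo products of first derivatives and terms in ∇²η multiplied by η. In
the combination of the theorem all second-order terms cancel; `half_curvature` does this for the
outer directions Z and φZ, and exchanging Z with X and subtracting gives the rest.

Among the surviving terms is twice the derivative of Φ in the direction (∇_Zφ)X - (∇_Xφ)Z.
Closedness shows that this vector is the metric dual of v ↦ (∇_vΦ)(Z,X), so expansion in an
orthonormal frame gives the sum over `E_i`; the remaining terms reduce by first-order identities. -/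

noncomputable section

/-! ### Differentiability of fields, and the bracket as a commutator of derivations -/

section Analysis

open Filter Topology

variable {E : Type*} [NormedAddCommGroup E] [NormedSpace ℝ E]
  {M : Type*} [TopologicalSpace M] [ChartedSpace E M] [IsManifold 𝓘(ℝ, E) ∞ M]

/-- The function `df(Y)` is differentiable when `f` is `C²` and `Y` is differentiable. -/
theorem mdifferentiableAt_mvfderiv_apply {f : M → ℝ} {Y : Π x : M, TangentSpace 𝓘(ℝ, E) x} {p : M}
    (hf : CMDiffAt 2 f p) (hY : MDiffAt (T% Y) p) :
    MDiffAt (fun y ↦ mvfderiv 𝓘(ℝ, E) f y (Y y)) p := by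
  have : IsManifold 𝓘(ℝ, E) 1 M := IsManifold.of_le (n := ∞) (by norm_cast)
  have : IsManifold 𝓘(ℝ, E) 2 M := IsManifold.of_le (n := ∞) (by norm_cast)
  have h := (hf.mfderiv_const (m := 1) (by norm_num)).mdifferentiableAt one_ne_zero
  have h2 : MDifferentiableAt 𝓘(ℝ, E) (𝓘(ℝ, ℝ).prod 𝓘(ℝ, ℝ))
      (fun y ↦ (TotalSpace.mk' ℝ (f y) (mfderiv 𝓘(ℝ, E) 𝓘(ℝ, ℝ) f y (Y y)) :
    TangentBundle 𝓘(ℝ, ℝ) ℝ)) p :=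
    MDifferentiableAt.clm_apply_of_inCoordinates (b₁ := id) (b₂ := f) h hY
      (hf.mdifferentiableAt (by norm_num))
  rw [mdifferentiableAt_totalSpace] at h2
  simp only [TotalSpace.mk'] at h2
  have h3 := h2.2
  simp at h3
  exact h3

/-- A vector field is differentiable if its inner products with the extensions of constant vectors
are. -/
theorem PseudoRiemannianMetric.mdifferentiableAt_of_inner [FiniteDimensional ℝ E]
    (g : PseudoRiemannianMetric E M) {s : Π x : M, TangentSpace 𝓘(ℝ, E) x} {p : M}
    (h : ∀ w : TangentSpace 𝓘(ℝ, E) p,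
      MDiffAt (fun y ↦ g.inner y (s y) (FiberBundle.extend E w y)) p) :
    MDiffAt (T% s) p := by
  have : CompleteSpace E := FiniteDimensional.complete ℝ E
  have hp := FiberBundle.mem_baseSet_trivializationAt' (F := E)
    (E := (TangentSpace 𝓘(ℝ, E) : M → Type _)) p
  set t := trivializationAt E (TangentSpace 𝓘(ℝ, E) : M → Type _) p with ht
  -- `G` is the metric in the trivialization at `p`, seen as a map from `E` to its dual. In
  -- coordinates `s = G⁻¹ (G s)`, and `G s` is controlled by the hypothesis through its values on a
  -- basis.
  let G : M → E →L[ℝ] E →L[ℝ] ℝ := fun y ↦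
    ContinuousLinearMap.inCoordinates E (TangentSpace 𝓘(ℝ, E) : M → Type _) (E →L[ℝ] ℝ)
      (fun x : M ↦ TangentSpace 𝓘(ℝ, E) x →L[ℝ] Bundle.Trivial M ℝ x) p y p y (g.inner y)
  have hG : MDiffAt G p :=
    ((mdifferentiableAt_hom_bundle _).1 (g.contMDiff.mdifferentiableAt (x := p) (by simp))).2
  have hGapp : ∀ y ∈ t.baseSet, ∀ v w, G y v w = g.inner y (t.symm y v) (t.symm y w) := by
    intro y hy v w
    simp only [G]
    rw [inCoordinates_apply_eq₂ hy hy (by simp)]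
    simp
    rfl
  have hGs : MDiffAt (fun y ↦ G y (t.continuousLinearMapAt ℝ y (s y))) p := by
    let b := Module.finBasis ℝ E
    have hsum (L : E →L[ℝ] ℝ) :
        L = ∑ i, L (b i) • LinearMap.toContinuousLinearMap (b.coord i) := by
      ext v
      conv_lhs => rw [← b.sum_repr v, map_sum]
      simp [mul_comm]
    have : (fun y ↦ G y (t.continuousLinearMapAt ℝ y (s y))) =
        ∑ i, (fun y ↦ G y (t.continuousLinearMapAt ℝ y (s y)) (b i)) •
          fun _ ↦ LinearMap.toContinuousLinearMap (b.coord i) :=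
      funext fun y ↦ (hsum _).trans (by simp)
    rw [this]
    refine MDifferentiableAt.sum fun i _ ↦ MDifferentiableAt.smul ?_ mdifferentiableAt_const
    refine (h (t.symm p (b i))).congr_of_eventuallyEq ?_
    filter_upwards [t.open_baseSet.mem_nhds hp] with y hy
    rw [hGapp y hy]
    simp [FiberBundle.extend, ← ht, hy, t.apply_mk_symm hp]
  have hinv : (G p).IsInvertible := by
    have hinj : Function.Injective (G p).toLinearMap := by
      refine (injective_iff_map_eq_zero _).2 fun v hv ↦ ?_
      have : t.symm p v = 0 := by
        refine g.nondegenerate p _ fun w ↦ ?_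
        have := (hGapp p hp v (t.continuousLinearMapAt ℝ p w)).symm.trans
          (congrArg (fun L : E →L[ℝ] ℝ ↦ L _) hv)
        rwa [← t.symmL_apply (R := ℝ) hp (t.continuousLinearMapAt ℝ p w),
          t.symmL_continuousLinearMapAt hp] at this
      have h2 := t.continuousLinearMapAt_symmL (R := ℝ) hp v
      rw [t.symmL_apply hp, this, map_zero] at h2
      exact h2.symm
    exact ⟨(LinearMap.linearEquivOfInjective (G p).toLinearMap hinj
      (Subspace.dual_finrank_eq.symm.trans (LinearMap.toContinuousLinearMap (𝕜 := ℝ)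
        (E := E) (F' := ℝ)).finrank_eq)).toContinuousLinearEquiv, by ext; rfl⟩
  have h1 : MDiffAt (fun y ↦ (G y).inverse) p :=
    (hinv.contDiffAt_map_inverse (n := 1)).differentiableAt one_ne_zero |>.comp_mdifferentiableAt hG
  have h2 : MDiffAt (fun y ↦ (G y).inverse (G y (t.continuousLinearMapAt ℝ y (s y)))) p :=
    h1.clm_apply hGs
  rw [mdifferentiableAt_section]
  refine h2.congr_of_eventuallyEq ?_
  have hopen : ∀ᶠ y in 𝓝 p, (G y).IsInvertible := by
    obtain ⟨e, he⟩ := hinv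
    filter_upwards [hG.continuousAt.preimage_mem_nhds (he ▸ e.nhds)] with y hy using hy
  filter_upwards [t.open_baseSet.mem_nhds hp, hopen] with y hy hy'
  rw [hy'.inverse_apply_eq.2 rfl]
  simp [← ht, hy]

/-- The Lie bracket acts on functions as the commutator of derivations. -/
theorem mvfderiv_mlieBracket [FiniteDimensional ℝ E]
    {X Y : Π x : M, TangentSpace 𝓘(ℝ, E) x} {f : M → ℝ} {p : M}
    (hX : CMDiffAt 2 (T% X) p) (hY : CMDiffAt 2 (T% Y) p) (hf : CMDiffAt 2 f p) :
    mvfderiv 𝓘(ℝ, E) f p (mlieBracket 𝓘(ℝ, E) X Y p) =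
      mvfderiv 𝓘(ℝ, E) (fun y ↦ mvfderiv 𝓘(ℝ, E) f y (Y y)) p (X p)
      - mvfderiv 𝓘(ℝ, E) (fun y ↦ mvfderiv 𝓘(ℝ, E) f y (X y)) p (Y p) := by
  have : IsManifold 𝓘(ℝ, E) 1 M := IsManifold.of_le (n := ∞) (by norm_cast)
  have : IsManifold 𝓘(ℝ, E) 2 M := IsManifold.of_le (n := ∞) (by norm_cast)
  have : IsManifold 𝓘(ℝ, E) 3 M := IsManifold.of_le (n := ∞) (by norm_cast)
  have : IsManifold 𝓘(ℝ, E) (((2 : ℕ∞) : ℕ∞ω) + 1) M := IsManifold.of_le (n := ∞) (by norm_cast)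
  have : IsManifold 𝓘(ℝ, E) (minSmoothness ℝ 3) M := by simpa
  have : CompleteSpace E := FiniteDimensional.complete ℝ E
  -- The argument needs a field that is nonzero at `p`, so dimension zero is treated apart.
  rcases subsingleton_or_nontrivial E with hE | hE
  · have h0 (x : M) (v : TangentSpace 𝓘(ℝ, E) x) : v = 0 := Subsingleton.elim (α := E) v 0
    rw [h0 _ (mlieBracket 𝓘(ℝ, E) X Y p), h0 _ (X p), h0 _ (Y p)]
    simp
  obtain ⟨w, hw⟩ : ∃ w : TangentSpace 𝓘(ℝ, E) p, w ≠ 0 := exists_ne (0 : E)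
  set Z : Π x : M, TangentSpace 𝓘(ℝ, E) x := FiberBundle.extend E w with hZdef
  have hZ : CMDiffAt 2 (T% Z) p := FiberBundle.contMDiffAt_extend ..
  have hZp : Z p = w := by simp [hZdef]
  have hfZ : CMDiffAt 2 (T% (f • Z)) p := hf.smul_section hZ
  have hf1 : MDiffAt f p := hf.mdifferentiableAt (by norm_num)
  have hZ1 : MDiffAt (T% Z) p := hZ.mdifferentiableAt (by norm_num)
  have hX1 : MDiffAt (T% X) p := hX.mdifferentiableAt (by norm_num)
  have hY1 : MDiffAt (T% Y) p := hY.mdifferentiableAt (by norm_num)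
  have hbr {V W : Π x : M, TangentSpace 𝓘(ℝ, E) x} (hV : CMDiffAt 2 (T% V) p)
      (hW : CMDiffAt 2 (T% W) p) : MDiffAt (T% (mlieBracket 𝓘(ℝ, E) V W)) p :=
    (ContMDiffAt.mlieBracket_vectorField (m := 1) (n := 2) hV hW
      (by simp; norm_num)).mdifferentiableAt one_ne_zero
  have key {V U : Π x : M, TangentSpace 𝓘(ℝ, E) x} (hV : CMDiffAt 2 (T% V) p) :
      mlieBracket 𝓘(ℝ, E) U (mlieBracket 𝓘(ℝ, E) V (f • Z)) p =
        mvfderiv 𝓘(ℝ, E) (fun y ↦ mvfderiv 𝓘(ℝ, E) f y (V y)) p (U p) • w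
        + mvfderiv 𝓘(ℝ, E) f p (V p) • mlieBracket 𝓘(ℝ, E) U Z p
        + (mvfderiv 𝓘(ℝ, E) f p (U p) • mlieBracket 𝓘(ℝ, E) V Z p
        + f p • mlieBracket 𝓘(ℝ, E) U (mlieBracket 𝓘(ℝ, E) V Z) p) := by
    have e : mlieBracket 𝓘(ℝ, E) V (f • Z) =ᶠ[𝓝 p]
        (fun y ↦ mvfderiv 𝓘(ℝ, E) f y (V y)) • Z + f • mlieBracket 𝓘(ℝ, E) V Z := by
      filter_upwards [(contMDiffAt_iff_contMDiffAt_nhds (by simp)).1 hf,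
        (contMDiffAt_iff_contMDiffAt_nhds (by simp)).1 hZ] with y hy hy'
      rw [mlieBracket_smul_right (hy.mdifferentiableAt (by norm_num))
        (hy'.mdifferentiableAt (by norm_num))]
      rfl
    have hd := mdifferentiableAt_mvfderiv_apply hf (hV.mdifferentiableAt (by norm_num))
    rw [EventuallyEq.rfl.mlieBracket_vectorField_eq e,
      mlieBracket_add_right (hd.smul_section hZ1) (hf1.smul_section (hbr hV hZ)),
      mlieBracket_smul_right hd hZ1, mlieBracket_smul_right hf1 (hbr hV hZ), hZp]
  -- Subtracting `f p` times the Jacobi identity for `Z` from the one for `f • Z` cancels every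
  -- bracket. What remains is a multiple of `w`, whose coefficient is the difference of the two
  -- sides.
  have J := leibniz_identity_mlieBracket_apply (U := X) (V := Y) (W := f • Z)
    (by simpa using hX) (by simpa using hY) (by simpa using hfZ)
  have J' := leibniz_identity_mlieBracket_apply (U := X) (V := Y) (W := Z)
    (by simpa using hX) (by simpa using hY) (by simpa using hZ)
  rw [key hY, key hX, mlieBracket_smul_right hf1 hZ1, hZp, J'] at J
  have : (mvfderiv 𝓘(ℝ, E) f p (mlieBracket 𝓘(ℝ, E) X Y p) -
      (mvfderiv 𝓘(ℝ, E) (fun y ↦ mvfderiv 𝓘(ℝ, E) f y (Y y)) p (X p)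
      - mvfderiv 𝓘(ℝ, E) (fun y ↦ mvfderiv 𝓘(ℝ, E) f y (X y)) p (Y p))) • w = 0 := by
    linear_combination (norm := module) -J
  exact sub_eq_zero.1 ((smul_eq_zero.1 this).resolve_right hw)

end Analysis

/-! ### Regularity of the Levi-Civita connection and symmetries of its curvature -/

section LeviCivita

open Filter Topology

variable {E : Type*} [NormedAddCommGroup E] [NormedSpace ℝ E]
  {M : Type*} [TopologicalSpace M] [ChartedSpace E M] [IsManifold 𝓘(ℝ, E) ∞ M]

theorem eventually_mdifferentiableAt {X : Π x : M, TangentSpace 𝓘(ℝ, E) x} {p : M}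
    (hX : CMDiffAt 2 (T% X) p) : ∀ᶠ y in 𝓝 p, MDiffAt (T% X) y := by
  filter_upwards [(contMDiffAt_iff_contMDiffAt_nhds (by simp)).1 hX] with y hy
  exact hy.mdifferentiableAt (by norm_num)

theorem mvfderiv_congr {M : Type*} [TopologicalSpace M] [ChartedSpace E M] {f h : M → ℝ} {p : M} (hfh : f =ᶠ[𝓝 p] h) :
    mvfderiv 𝓘(ℝ, E) f p = mvfderiv 𝓘(ℝ, E) h p := by
  ext v
  have h1 := hfh.mfderiv_eq (I := 𝓘(ℝ, E)) (I' := 𝓘(ℝ, ℝ))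
  have h2 := congrArg (fun L : E →L[ℝ] ℝ ↦ L v) h1
  exact h2

theorem mdifferentiableAt_mlieBracket [FiniteDimensional ℝ E]
    {X Y : Π x : M, TangentSpace 𝓘(ℝ, E) x} {p : M}
    (hX : CMDiffAt 2 (T% X) p) (hY : CMDiffAt 2 (T% Y) p) :
    MDiffAt (T% (mlieBracket 𝓘(ℝ, E) X Y)) p := by
  have : IsManifold 𝓘(ℝ, E) (((2 : ℕ∞) : ℕ∞ω) + 1) M := IsManifold.of_le (n := ∞) (by norm_cast)
  have : CompleteSpace E := FiniteDimensional.complete ℝ E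
  have : IsManifold 𝓘(ℝ, E) (minSmoothness ℝ 2) M := by
    simpa using IsManifold.of_le (n := ∞) (by norm_cast)
  exact (ContMDiffAt.mlieBracket_vectorField (m := 1) (n := 2) hX hY
    (by simp; norm_num)).mdifferentiableAt one_ne_zero

theorem CovariantDerivative.congr_of_eventuallyEq [FiniteDimensional ℝ E]
    (cov : CovariantDerivative 𝓘(ℝ, E) E (TangentSpace 𝓘(ℝ, E) : M → Type _))
    {X Y : Π x : M, TangentSpace 𝓘(ℝ, E) x} {p : M}
    (hX : MDiffAt (T% X) p) (hY : MDiffAt (T% Y) p) (h : X =ᶠ[𝓝 p] Y) : cov X p = cov Y p := by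
  have := cov.isCovariantDerivativeOnUniv.congr_of_eventuallyEq hX hY univ_mem h
  exact this

namespace PseudoRiemannianMetric

variable (g : PseudoRiemannianMetric E M)

theorem contMDiffAt_inner {X Y : Π x : M, TangentSpace 𝓘(ℝ, E) x} {x : M} {n : ℕ∞}
    (hX : CMDiffAt n (T% X) x) (hY : CMDiffAt n (T% Y) x) :
    CMDiffAt n (fun y ↦ g.inner y (X y) (Y y)) x := by
  have : ContMDiffAt 𝓘(ℝ, E) (𝓘(ℝ, E).prod 𝓘(ℝ)) n
      (fun m ↦ TotalSpace.mk' ℝ (E := Bundle.Trivial M ℝ) m (g.inner m (X m) (Y m))) x := by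
    apply ContMDiffAt.clm_bundle_apply₂ (F₁ := E) (F₂ := E)
    · exact g.contMDiff.contMDiffAt.of_le (by exact_mod_cast le_top)
    · exact hX
    · exact hY
  simp only [contMDiffAt_totalSpace] at this
  exact this.2

variable [FiniteDimensional ℝ E]

theorem mdifferentiableAt_koszul {X Y Z : Π x : M, TangentSpace 𝓘(ℝ, E) x} {p : M}
    (hX : CMDiffAt 2 (T% X) p) (hY : CMDiffAt 2 (T% Y) p) (hZ : CMDiffAt 2 (T% Z) p) :
    MDiffAt (g.koszul X Y Z) p := by
  have hX1 : MDiffAt (T% X) p := hX.mdifferentiableAt (by norm_num)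
  have hY1 : MDiffAt (T% Y) p := hY.mdifferentiableAt (by norm_num)
  have hZ1 : MDiffAt (T% Z) p := hZ.mdifferentiableAt (by norm_num)
  exact (((((mdifferentiableAt_mvfderiv_apply (g.contMDiffAt_inner (n := 2) hY hZ) hX1).add
    (mdifferentiableAt_mvfderiv_apply (g.contMDiffAt_inner (n := 2) hZ hX) hY1)).sub
    (mdifferentiableAt_mvfderiv_apply (g.contMDiffAt_inner (n := 2) hX hY) hZ1)).add
    (g.mdifferentiableAt_inner (mdifferentiableAt_mlieBracket hX hY) hZ1)).sub
    (g.mdifferentiableAt_inner (mdifferentiableAt_mlieBracket hY hZ) hX1)).add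
    (g.mdifferentiableAt_inner (mdifferentiableAt_mlieBracket hZ hX) hY1)

/-- `∇_X Y` is differentiable when `X` and `Y` are `C²`. -/
theorem mdifferentiableAt_leviCivita {X Y : Π x : M, TangentSpace 𝓘(ℝ, E) x} {p : M}
    (hX : CMDiffAt 2 (T% X) p) (hY : CMDiffAt 2 (T% Y) p) :
    MDiffAt (T% (fun y ↦ g.leviCivita Y y (X y))) p := by
  refine g.mdifferentiableAt_of_inner fun w ↦ ?_
  have hZ : CMDiffAt 2 (T% (FiberBundle.extend E w)) p := FiberBundle.contMDiffAt_extend ..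
  -- The Koszul formula must hold on a neighbourhood of `p`, which is why `C²` fields are assumed
  -- rather than differentiability at `p`.
  refine ((g.mdifferentiableAt_koszul hX hY hZ).const_smul (1 / 2 : ℝ)).congr_of_eventuallyEq ?_
  filter_upwards [eventually_mdifferentiableAt hX, eventually_mdifferentiableAt hY,
    eventually_mdifferentiableAt hZ] with y hXy hYy hZy
  have := g.inner_leviCivitaFun hXy hYy hZy
  simp only [leviCivita, Pi.smul_apply, smul_eq_mul]
  linarith

theorem leviCivita_sub {X Y : Π x : M, TangentSpace 𝓘(ℝ, E) x} {p : M}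
    (hX : MDiffAt (T% X) p) (hY : MDiffAt (T% Y) p) :
    g.leviCivita (fun y ↦ X y - Y y) p = g.leviCivita X p - g.leviCivita Y p := by
  have h := g.leviCivita.isCovariantDerivativeOnUniv.add (mdifferentiableAt_sub_section hX hY) hY
    (Set.mem_univ p)
  rw [sub_add_cancel] at h
  rw [h, add_sub_cancel_right]
  rfl

/-- The operator XY - YX - [X,Y] annihilates the function g(Z,W). Expanded by metric compatibility,
the products of two first derivatives cancel and the two curvature terms remain. -/
theorem riemann_skew {X Y Z W : Π x : M, TangentSpace 𝓘(ℝ, E) x} {p : M}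
    (hX : CMDiffAt 2 (T% X) p) (hY : CMDiffAt 2 (T% Y) p) (hZ : CMDiffAt 2 (T% Z) p)
    (hW : CMDiffAt 2 (T% W) p) :
    g.riemann X Y Z W p = -g.riemann X Y W Z p := by
  have md {X : Π x : M, TangentSpace 𝓘(ℝ, E) x} (hX : CMDiffAt 2 (T% X) p) :
    MDiffAt (T% X) p := hX.mdifferentiableAt (by norm_num)
  have key {X Y : Π x : M, TangentSpace 𝓘(ℝ, E) x} (hX : CMDiffAt 2 (T% X) p)
      (hY : CMDiffAt 2 (T% Y) p) :
      mvfderiv 𝓘(ℝ, E) (fun y ↦ mvfderiv 𝓘(ℝ, E) (fun z ↦ g.inner z (Z z) (W z)) y (Y y)) p (X p) =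
      g.inner p (g.leviCivita (fun y ↦ g.leviCivita Z y (Y y)) p (X p)) (W p)
      + g.inner p (g.leviCivita Z p (Y p)) (g.leviCivita W p (X p))
      + (g.inner p (g.leviCivita Z p (X p)) (g.leviCivita W p (Y p))
      + g.inner p (Z p) (g.leviCivita (fun y ↦ g.leviCivita W y (Y y)) p (X p))) := by
    have h1 : (fun y ↦ mvfderiv 𝓘(ℝ, E) (fun z ↦ g.inner z (Z z) (W z)) y (Y y)) =ᶠ[𝓝 p]
        (fun y ↦ g.inner y (g.leviCivita Z y (Y y)) (W y)) +
        fun y ↦ g.inner y (Z y) (g.leviCivita W y (Y y)) := by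
      filter_upwards [eventually_mdifferentiableAt hY, eventually_mdifferentiableAt hZ,
        eventually_mdifferentiableAt hW] with y hYy hZy hWy
      exact g.mvfderiv_inner_eq hYy hZy hWy
    rw [mvfderiv_congr h1,
      mvfderiv_add (g.mdifferentiableAt_inner (g.mdifferentiableAt_leviCivita hY hZ) (md hW))
        (g.mdifferentiableAt_inner (md hZ) (g.mdifferentiableAt_leviCivita hY hW)),
      _root_.add_apply,
      g.mvfderiv_inner_eq (md hX) (g.mdifferentiableAt_leviCivita hY hZ) (md hW),
      g.mvfderiv_inner_eq (md hX) (md hZ) (g.mdifferentiableAt_leviCivita hY hW)]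
  have h := mvfderiv_mlieBracket hX hY (g.contMDiffAt_inner (n := 2) hZ hW)
  rw [key hX hY, key hY hX,
    g.mvfderiv_inner_eq (mdifferentiableAt_mlieBracket hX hY) (md hZ) (md hW)] at h
  simp only [riemann, curvature, map_sub, _root_.sub_apply]
  rw [g.symm p _ (Z p), g.symm p _ (Z p), g.symm p _ (Z p)]
  linarith

/-- The first Bianchi identity. -/
theorem curvature_cyclic {X Y Z : Π x : M, TangentSpace 𝓘(ℝ, E) x} {p : M}
    (hX : CMDiffAt 2 (T% X) p) (hY : CMDiffAt 2 (T% Y) p) (hZ : CMDiffAt 2 (T% Z) p) :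
    g.curvature X Y Z p + g.curvature Y Z X p + g.curvature Z X Y p = 0 := by
  have : IsManifold 𝓘(ℝ, E) (minSmoothness ℝ 3) M := by
    simpa using IsManifold.of_le (n := ∞) (by norm_cast)
  have : CompleteSpace E := FiniteDimensional.complete ℝ E
  have md {X : Π x : M, TangentSpace 𝓘(ℝ, E) x} (hX : CMDiffAt 2 (T% X) p) :
    MDiffAt (T% X) p := hX.mdifferentiableAt (by norm_num)
  -- Torsion-freeness enters twice: for `X` and `[Y, Z]` at `p`, and for `Y` and `Z` near `p`. The
  -- cyclic sum of these equations reduces the claim to the Jacobi identity.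
  have key {X Y Z : Π x : M, TangentSpace 𝓘(ℝ, E) x} (hX : CMDiffAt 2 (T% X) p)
      (hY : CMDiffAt 2 (T% Y) p) (hZ : CMDiffAt 2 (T% Z) p) :
      g.leviCivita (fun y ↦ g.leviCivita Z y (Y y)) p (X p)
        - g.leviCivita (fun y ↦ g.leviCivita Y y (Z y)) p (X p)
        - g.leviCivita X p (mlieBracket 𝓘(ℝ, E) Y Z p)
        = mlieBracket 𝓘(ℝ, E) X (mlieBracket 𝓘(ℝ, E) Y Z) p := by
    rw [← g.leviCivita_sub_swap (md hX) (mdifferentiableAt_mlieBracket hY hZ),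
      ← _root_.sub_apply, ← g.leviCivita_sub (g.mdifferentiableAt_leviCivita hY hZ)
      (g.mdifferentiableAt_leviCivita hZ hY)]
    congr 2
    refine g.leviCivita.congr_of_eventuallyEq (mdifferentiableAt_sub_section
      (g.mdifferentiableAt_leviCivita hY hZ) (g.mdifferentiableAt_leviCivita hZ hY))
      (mdifferentiableAt_mlieBracket hY hZ) ?_
    filter_upwards [eventually_mdifferentiableAt hY, eventually_mdifferentiableAt hZ]
      with y hYy hZy
    exact g.leviCivita_sub_swap hYy hZy
  have J := leibniz_identity_mlieBracket_apply (U := X) (V := Y) (W := Z)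
    (by simpa using hX) (by simpa using hY) (by simpa using hZ)
  rw [mlieBracket_swap_apply (V := mlieBracket 𝓘(ℝ, E) X Y), mlieBracket_swap (V := X) (W := Z),
    ← neg_one_smul ℝ (mlieBracket 𝓘(ℝ, E) Z X),
    mlieBracket_const_smul_right (mdifferentiableAt_mlieBracket hZ hX)] at J
  have h1 := key hX hY hZ
  have h2 := key hY hZ hX
  have h3 := key hZ hX hY
  simp only [curvature]
  linear_combination (norm := module) h1 + h2 + h3 + J

end PseudoRiemannianMetric

end LeviCivita

/-! ### Algebra of the structure and first covariant derivatives -/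

namespace AlmostParaContactMetricStructure

open Filter Topology

variable {ε₀ ε₁ : ℝ} {E : Type*} [NormedAddCommGroup E] [NormedSpace ℝ E]
  {M : Type*} [TopologicalSpace M] [ChartedSpace E M] [IsManifold 𝓘(ℝ, E) ∞ M]
  (S : AlmostParaContactMetricStructure ε₀ ε₁ E M)

theorem contMDiffAt_φField {X : Π x : M, TangentSpace 𝓘(ℝ, E) x} {x : M}
    (hX : CMDiffAt 2 (T% X) x) : CMDiffAt 2 (T% (S.φField X)) x :=
  ContMDiffAt.clm_bundle_apply (F₁ := E) (F₂ := E)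
    (S.contMDiff_φ.contMDiffAt.of_le (by norm_cast)) hX

theorem mdifferentiableAt_φField {X : Π x : M, TangentSpace 𝓘(ℝ, E) x} {x : M}
    (hX : MDiffAt (T% X) x) : MDiffAt (T% (S.φField X)) x :=
  MDifferentiableAt.clm_bundle_apply (F₁ := E) (F₂ := E)
    (S.contMDiff_φ.mdifferentiableAt (by simp)) hX

theorem contMDiffAt_ξ (x : M) : CMDiffAt 2 (T% S.ξ) x :=
  S.contMDiff_ξ.contMDiffAt.of_le (by norm_cast)

theorem mdifferentiableAt_ξ (x : M) : MDiffAt (T% S.ξ) x :=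
  S.contMDiff_ξ.mdifferentiableAt (by simp)

section Algebra

variable {x : M} (v w : TangentSpace 𝓘(ℝ, E) x)

/-- Since φ²ξ = 0, evaluating φ² on φξ gives φξ = cξ with c = η(φξ); then φ²ξ = c²ξ forces c = 0. -/
theorem φ_ξ (hε₁ : ε₁ ^ 2 = 1) (x : M) : S.φ x (S.ξ x) = 0 := by
  have h1 : S.φ x (S.φ x (S.ξ x)) = 0 := by rw [S.φ_φ, S.η_ξ]; simp
  have h2 := S.φ_φ x (S.φ x (S.ξ x))
  rw [h1, map_zero] at h2
  have h0 : ε₁ ≠ 0 := by rintro rfl; norm_num at hε₁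
  have h3 := sub_eq_zero.1 ((smul_eq_zero.1 h2.symm).resolve_left h0)
  set c := S.η x (S.φ x (S.ξ x)) with hc
  have h4 := h1
  rw [h3, map_smul, h3, smul_smul] at h4
  have h5 := congrArg (S.η x) h4
  rw [map_smul, S.η_ξ, map_zero, smul_eq_mul, mul_one, mul_self_eq_zero] at h5
  rw [h3, h5, zero_smul]

/-- Both readings of φ³v, as φ²(φv) and as φ(φ²v), are compared using φξ = 0. -/
theorem η_φ (hε₁ : ε₁ ^ 2 = 1) : S.η x (S.φ x v) = 0 := by
  have h1 := S.φ_φ x (S.φ x v)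
  nth_rewrite 1 [S.φ_φ x v] at h1
  rw [map_smul, map_sub, map_smul, S.φ_ξ hε₁, smul_zero, sub_zero] at h1
  have h0 : ε₁ ≠ 0 := by rintro rfl; norm_num at hε₁
  have h2 := congrArg (S.η x) (smul_right_injective _ h0 h1)
  simp only [map_sub, map_smul, S.η_ξ, smul_eq_mul, mul_one, sub_self] at h2
  exact h2

theorem inner_ξ (hε₁ : ε₁ ^ 2 = 1) : S.g.inner x v (S.ξ x) = ε₀ * S.η x v := by
  have h1 := S.inner_φ_φ x v (S.ξ x)
  have h0 : ε₁ ≠ 0 := by rintro rfl; norm_num at hε₁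
  rw [S.φ_ξ hε₁, map_zero, S.η_ξ] at h1
  have := (mul_eq_zero.1 h1.symm).resolve_left (neg_ne_zero.2 h0)
  linarith

theorem inner_φ_right (hε₁ : ε₁ ^ 2 = 1) :
    S.g.inner x v (S.φ x w) = -S.g.inner x (S.φ x v) w := by
  have h1 := S.inner_φ_φ x v (S.φ x w)
  have h0 : ε₁ ≠ 0 := by rintro rfl; norm_num at hε₁
  rw [S.φ_φ, S.η_φ _ hε₁, map_smul, map_sub, map_smul, S.inner_ξ _ hε₁, S.η_φ _ hε₁] at h1
  simp only [smul_eq_mul] at h1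
  apply mul_left_cancel₀ h0
  linarith

end Algebra

variable [FiniteDimensional ℝ E]

/-- Tensoriality lets ∇φ act on tangent vectors at a point, such as values of ∇φ itself, without
choosing extensions. -/
theorem tensorialAt_covφ (x : M) :
    TensorialAt 𝓘(ℝ, E) E (fun Y : Π x : M, TangentSpace 𝓘(ℝ, E) x ↦
      S.g.leviCivita (S.φField Y) x - S.φ x ∘L S.g.leviCivita Y x) x where
  smul {f Y} hf hY := by
    have h1 : S.φField (f • Y) = f • S.φField Y := by
      ext y; simp [φField]
    rw [h1, S.g.leviCivita.isCovariantDerivativeOnUniv.leibniz hY hf,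
      S.g.leviCivita.isCovariantDerivativeOnUniv.leibniz (S.mdifferentiableAt_φField hY) hf]
    ext u
    simp [φField, smul_sub]
  add {Y Y'} hY hY' := by
    have h1 : S.φField (Y + Y') = S.φField Y + S.φField Y' := by
      ext y; simp [φField]
    rw [h1, S.g.leviCivita.isCovariantDerivativeOnUniv.add hY hY',
      S.g.leviCivita.isCovariantDerivativeOnUniv.add (S.mdifferentiableAt_φField hY)
        (S.mdifferentiableAt_φField hY')]
    ext u
    simp
    abel

/-- The covariant derivative of `φ` as a tensor, `S.covφ x w u = (∇_u φ) w`. -/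
def covφ (x : M) : TangentSpace 𝓘(ℝ, E) x →L[ℝ]
    TangentSpace 𝓘(ℝ, E) x →L[ℝ] TangentSpace 𝓘(ℝ, E) x :=
  TensorialAt.mkHom _ x (S.tensorialAt_covφ x)

theorem covφ_apply {Y : Π x : M, TangentSpace 𝓘(ℝ, E) x} {x : M} (hY : MDiffAt (T% Y) x)
    (u : TangentSpace 𝓘(ℝ, E) x) :
    S.covφ x (Y x) u = S.g.leviCivita (S.φField Y) x u - S.φ x (S.g.leviCivita Y x u) := by
  rw [covφ, TensorialAt.mkHom_apply (S.tensorialAt_covφ x) hY]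
  rfl

/-- The covariant derivative of `η` as a tensor, `S.covη x u v = (∇_u η) v`. -/
def covη (x : M) (u v : TangentSpace 𝓘(ℝ, E) x) : ℝ :=
  ε₀ * S.g.inner x (S.g.leviCivita S.ξ x u) v

/-- The covariant derivative of `Φ` as a tensor, `S.covΦTensor x u v w = (∇_u Φ)(v, w)`. -/
def covΦTensor (x : M) (u v w : TangentSpace 𝓘(ℝ, E) x) : ℝ :=
  S.g.inner x v (S.covφ x w u)

theorem mvfderiv_inner_eq' {Y Z : Π x : M, TangentSpace 𝓘(ℝ, E) x} {x : M}
    (hY : MDiffAt (T% Y) x) (hZ : MDiffAt (T% Z) x) (u : TangentSpace 𝓘(ℝ, E) x) :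
    mvfderiv 𝓘(ℝ, E) (fun y ↦ S.g.inner y (Y y) (Z y)) x u =
      S.g.inner x (S.g.leviCivita Y x u) (Z x) + S.g.inner x (Y x) (S.g.leviCivita Z x u) := by
  have := S.g.mvfderiv_inner_eq (X := FiberBundle.extend E u)
    (FiberBundle.mdifferentiableAt_extend ..) hY hZ
  simpa using this

theorem covΦ_eq {Y Z : Π x : M, TangentSpace 𝓘(ℝ, E) x} {x : M}
    (hY : MDiffAt (T% Y) x) (hZ : MDiffAt (T% Z) x) (u : TangentSpace 𝓘(ℝ, E) x) :
    S.covΦ x u Y Z = S.covΦTensor x u (Y x) (Z x) := by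
  have := S.mvfderiv_inner_eq' hY (S.mdifferentiableAt_φField hZ) u
  simp only [φField] at this
  rw [covΦTensor, S.covφ_apply hZ, covΦ]
  simp only [Φ, map_sub]
  rw [this]
  unfold φField
  ring

section FirstOrder

variable {x : M} (u v w : TangentSpace 𝓘(ℝ, E) x)

theorem covΦTensor_skew (hε₁ : ε₁ ^ 2 = 1) :
    S.covΦTensor x u v w = -S.covΦTensor x u w v := by
  obtain ⟨V, hV, rfl⟩ : ∃ X : Π x : M, TangentSpace 𝓘(ℝ, E) x, MDiffAt (T% X) x ∧ X x = v :=
    ⟨FiberBundle.extend E v, FiberBundle.mdifferentiableAt_extend .., by simp⟩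
  obtain ⟨W, hW, rfl⟩ : ∃ X : Π x : M, TangentSpace 𝓘(ℝ, E) x, MDiffAt (T% X) x ∧ X x = w :=
    ⟨FiberBundle.extend E w, FiberBundle.mdifferentiableAt_extend .., by simp⟩
  have h1 := S.mvfderiv_inner_eq' hV (S.mdifferentiableAt_φField hW) u
  have h2 := S.mvfderiv_inner_eq' (S.mdifferentiableAt_φField hV) hW u
  have h3 : (fun y ↦ S.g.inner y (V y) (S.φField W y)) =
      -fun y ↦ S.g.inner y (S.φField V y) (W y) := by
    ext y
    exact S.inner_φ_right _ _ hε₁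
  rw [h3, mvfderiv_neg, _root_.neg_apply, h2] at h1
  simp only [covΦTensor, S.covφ_apply hV, S.covφ_apply hW, map_sub, S.inner_φ_right _ _ hε₁,
    S.g.symm x (S.g.leviCivita (S.φField V) x u)] at h1 ⊢
  have h4 := S.inner_φ_right (S.g.leviCivita V x u) (W x) hε₁
  have h5 := S.inner_φ_right (W x) (S.g.leviCivita V x u) hε₁
  have h6 := S.g.symm x (S.φ x (W x)) (S.g.leviCivita V x u)
  simp only [φField] at h1 ⊢
  linarith

theorem covη_ξ (hε₁ : ε₁ ^ 2 = 1) : S.covη x u (S.ξ x) = 0 := by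
  have h1 := S.mvfderiv_inner_eq' (S.mdifferentiableAt_ξ x) (S.mdifferentiableAt_ξ x) u
  have h2 : (fun y ↦ S.g.inner y (S.ξ y) (S.ξ y)) = fun _ ↦ ε₀ := by
    ext y
    rw [S.inner_ξ _ hε₁, S.η_ξ, mul_one]
  rw [h2, mvfderiv_const, S.g.symm x (S.ξ x)] at h1
  rw [_root_.zero_apply] at h1
  rw [covη]
  linear_combination (-ε₀ / 2) * h1

theorem covφ_ξ (hε₁ : ε₁ ^ 2 = 1) : S.covφ x (S.ξ x) u = -S.φ x (S.g.leviCivita S.ξ x u) := by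
  have : S.φField S.ξ = 0 := by
    ext y; exact S.φ_ξ hε₁ y
  rw [S.covφ_apply (S.mdifferentiableAt_ξ x), this, CovariantDerivative.zero]
  simp

theorem covΦTensor_ξ_right (hε₀ : ε₀ ^ 2 = 1) (hε₁ : ε₁ ^ 2 = 1) :
    S.covΦTensor x u v (S.ξ x) = ε₀ * S.covη x u (S.φ x v) := by
  rw [covΦTensor, S.covφ_ξ _ hε₁, map_neg, S.inner_φ_right _ _ hε₁, covη, S.g.symm]
  linear_combination (-S.g.inner x (S.g.leviCivita S.ξ x u) (S.φ x v)) * hε₀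

theorem mvfderiv_η_eq {Y : Π x : M, TangentSpace 𝓘(ℝ, E) x} (hε₀ : ε₀ ^ 2 = 1)
    (hε₁ : ε₁ ^ 2 = 1) (hY : MDiffAt (T% Y) x) :
    MDiffAt (fun y ↦ S.η y (Y y)) x ∧ mvfderiv 𝓘(ℝ, E) (fun y ↦ S.η y (Y y)) x u =
      S.covη x u (Y x) + S.η x (S.g.leviCivita Y x u) := by
  -- As ε₀² = 1, `inner_ξ` inverts to η = ε₀ g(·, ξ); this is what makes `covη` the derivative of η.
  have h2 : (fun y ↦ S.η y (Y y)) = (fun _ ↦ ε₀) * fun y ↦ S.g.inner y (Y y) (S.ξ y) := by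
    ext y
    simp only [Pi.mul_apply]
    rw [S.inner_ξ _ hε₁]
    linear_combination (-S.η y (Y y)) * hε₀
  have hd := S.g.mdifferentiableAt_inner hY (S.mdifferentiableAt_ξ x)
  rw [h2]
  refine ⟨mdifferentiableAt_const.mul hd, ?_⟩
  rw [mvfderiv_mul mdifferentiableAt_const hd, mvfderiv_const]
  simp only [smul_zero, add_zero, _root_.smul_apply, smul_eq_mul]
  rw [S.mvfderiv_inner_eq' hY (S.mdifferentiableAt_ξ x), S.inner_ξ _ hε₁, covη, S.g.symm x (Y x)]
  linear_combination (S.η x (S.g.leviCivita Y x u)) * hε₀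

/-- This is the Leibniz rule applied to φ² = ε₁(I - η⊗ξ). -/
theorem covφ_φ (hε₀ : ε₀ ^ 2 = 1) (hε₁ : ε₁ ^ 2 = 1) :
    S.covφ x (S.φ x w) u = -S.φ x (S.covφ x w u)
      - ε₁ • (S.covη x u w • S.ξ x + S.η x w • S.g.leviCivita S.ξ x u) := by
  obtain ⟨W, hW, rfl⟩ : ∃ X : Π x : M, TangentSpace 𝓘(ℝ, E) x, MDiffAt (T% X) x ∧ X x = w :=
    ⟨FiberBundle.extend E w, FiberBundle.mdifferentiableAt_extend .., by simp⟩
  have h1 := S.covφ_apply (S.mdifferentiableAt_φField hW) u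
  have hη := S.mvfderiv_η_eq u hε₀ hε₁ hW
  have h2 : S.φField (S.φField W) = (fun _ : M ↦ ε₁) • (W - (fun y ↦ S.η y (W y)) • S.ξ) := by
    ext y
    exact S.φ_φ y _
  have hs := hη.1.smul_section (S.mdifferentiableAt_ξ x)
  have h3 : S.g.leviCivita (S.φField (S.φField W)) x = ε₁ • (S.g.leviCivita W x -
      (S.η x (W x) • S.g.leviCivita S.ξ x
        + (mvfderiv 𝓘(ℝ, E) (fun y ↦ S.η y (W y)) x).smulRight (S.ξ x))) := by
    rw [h2, S.g.leviCivita.isCovariantDerivativeOnUniv.leibniz (mdifferentiableAt_sub_section hW hs)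
      mdifferentiableAt_const, mvfderiv_const]
    have h4 := S.g.leviCivita_sub hW hs
    have h5 := S.g.leviCivita.isCovariantDerivativeOnUniv.leibniz (S.mdifferentiableAt_ξ x) hη.1
    rw [h5] at h4
    ext u
    simp only [← h4]
    simp
    rfl
  change S.covφ x (S.φField W x) u = _
  rw [h1, h3, S.covφ_apply hW, map_sub, S.φ_φ]
  simp only [_root_.smul_apply, _root_.sub_apply, _root_.add_apply,
    ContinuousLinearMap.smulRight_apply, hη.2]
  module

theorem covΦTensor_φ_right (hε₀ : ε₀ ^ 2 = 1) (hε₁ : ε₁ ^ 2 = 1) :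
    S.covΦTensor x u v (S.φ x w) = S.covΦTensor x u (S.φ x v) w
      - ε₀ * ε₁ * (S.covη x u v * S.η x w + S.η x v * S.covη x u w) := by
  rw [covΦTensor, S.covφ_φ _ _ hε₀ hε₁]
  simp only [map_sub, map_neg, map_smul, map_add, smul_eq_mul, S.inner_φ_right _ _ hε₁,
    S.inner_ξ _ hε₁, covΦTensor]
  rw [S.g.symm x v]
  simp only [covη]
  linear_combination (ε₁ * S.η x w * S.g.inner x (S.g.leviCivita S.ξ x u) v) * hε₀

variable {S}

/-- Torsion-freeness turns dη into the antisymmetrization of ∇η; the factor 2 undoes the ½ in the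
normalization of dη. -/
theorem IsParaContact.covη_sub_swap (hS : S.IsParaContact) (hε₀ : ε₀ ^ 2 = 1)
    (hε₁ : ε₁ ^ 2 = 1) :
    S.covη x u v - S.covη x v u = 2 * S.Φ x u v := by
  set U : Π x : M, TangentSpace 𝓘(ℝ, E) x := FiberBundle.extend E u with hU
  set V : Π x : M, TangentSpace 𝓘(ℝ, E) x := FiberBundle.extend E v with hV
  have hUx : U x = u := by simp [hU]
  have hVx : V x = v := by simp [hV]
  have hUd : MDiffAt (T% U) x := FiberBundle.mdifferentiableAt_extend ..
  have hVd : MDiffAt (T% V) x := FiberBundle.mdifferentiableAt_extend ..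
  have h := hS x U V (FiberBundle.contMDiffAt_extend ..) (FiberBundle.contMDiffAt_extend ..)
  rw [dη, (S.mvfderiv_η_eq _ hε₀ hε₁ hUd).2, (S.mvfderiv_η_eq _ hε₀ hε₁ hVd).2,
    ← S.g.leviCivita_sub_swap hUd hVd, map_sub, hUx, hVx] at h
  linarith

end FirstOrder

end AlmostParaContactMetricStructure

/-! ### Differentiating pointwise identities along a tangent vector -/

section DerivAlong

open Filter Topology

variable {E : Type*} [NormedAddCommGroup E] [NormedSpace ℝ E]
  {M : Type*} [TopologicalSpace M] [ChartedSpace E M]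

/-- `f` is differentiable at `p`, with derivative `c` in the direction of the tangent vector `u`. -/
def HasDerivAlong (f : M → ℝ) (p : M) (u : TangentSpace 𝓘(ℝ, E) p) (c : ℝ) : Prop :=
  MDifferentiableAt 𝓘(ℝ, E) 𝓘(ℝ, ℝ) f p ∧ mvfderiv 𝓘(ℝ, E) f p u = c

namespace HasDerivAlong

variable {f h : M → ℝ} {p : M} {u : TangentSpace 𝓘(ℝ, E) p} {c d : ℝ}

theorem add (hf : HasDerivAlong f p u c) (hh : HasDerivAlong h p u d) :
    HasDerivAlong (fun y ↦ f y + h y) p u (c + d) := by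
  refine ⟨hf.1.add hh.1, ?_⟩
  have := mvfderiv_add hf.1 hh.1
  rw [← hf.2, ← hh.2, ← _root_.add_apply, ← this]
  rfl

theorem mul (hf : HasDerivAlong f p u c) (hh : HasDerivAlong h p u d) :
    HasDerivAlong (fun y ↦ f y * h y) p u (f p * d + h p * c) := by
  refine ⟨hf.1.mul hh.1, ?_⟩
  have := congrArg (fun L ↦ L u) (mvfderiv_mul hf.1 hh.1)
  rw [← hf.2, ← hh.2]
  exact this.trans (by simp)

theorem const (p : M) (u : TangentSpace 𝓘(ℝ, E) p) (a : ℝ) :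
    HasDerivAlong (fun _ ↦ a) p u 0 :=
  ⟨mdifferentiableAt_const, by rw [mvfderiv_const]; simp⟩

theorem const_mul (a : ℝ) (hf : HasDerivAlong f p u c) :
    HasDerivAlong (fun y ↦ a * f y) p u (a * c) := by
  simpa using (const p u a).mul hf

theorem unique (hf : HasDerivAlong f p u c) (hh : HasDerivAlong h p u d) (hfh : ∀ y, f y = h y) :
    c = d := by
  rw [← hf.2, ← hh.2, funext hfh]

end HasDerivAlong

end DerivAlong

/-! ### Second covariant derivatives, Ricci identities and closedness of Φ -/

namespace AlmostParaContactMetricStructure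

open Filter Topology

variable {ε₀ ε₁ : ℝ} {E : Type*} [NormedAddCommGroup E] [NormedSpace ℝ E]
  {M : Type*} [TopologicalSpace M] [ChartedSpace E M] [IsManifold 𝓘(ℝ, E) ∞ M]
  (S : AlmostParaContactMetricStructure ε₀ ε₁ E M)

theorem Φ_eq {x : M} (v w : TangentSpace 𝓘(ℝ, E) x) : S.Φ x v w = S.g.inner x v (S.φ x w) := rfl

theorem Φ_skew (hε₁ : ε₁ ^ 2 = 1) {x : M} (v w : TangentSpace 𝓘(ℝ, E) x) :
    S.Φ x v w = -S.Φ x w v := by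
  rw [Φ, Φ, S.inner_φ_right _ _ hε₁, S.g.symm]

theorem Φ_φ_right (hε₁ : ε₁ ^ 2 = 1) {x : M} (v w : TangentSpace 𝓘(ℝ, E) x) :
    S.Φ x v (S.φ x w) = ε₁ * (S.g.inner x v w - ε₀ * S.η x v * S.η x w) := by
  simp only [Φ, S.φ_φ, map_smul, map_sub, smul_eq_mul, S.inner_ξ _ hε₁]
  ring

theorem Φ_φ_φ (hε₁ : ε₁ ^ 2 = 1) {x : M} (v w : TangentSpace 𝓘(ℝ, E) x) :
    S.Φ x (S.φ x v) (S.φ x w) = -ε₁ * S.Φ x v w := by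
  rw [S.Φ_φ_right hε₁, S.η_φ _ hε₁, Φ, S.inner_φ_right _ _ hε₁]
  ring

theorem Φ_ξ_right (hε₁ : ε₁ ^ 2 = 1) {x : M} (v : TangentSpace 𝓘(ℝ, E) x) :
    S.Φ x v (S.ξ x) = 0 := by
  rw [Φ, S.φ_ξ hε₁, map_zero]

theorem Φ_ξ_left (hε₁ : ε₁ ^ 2 = 1) {x : M} (v : TangentSpace 𝓘(ℝ, E) x) :
    S.Φ x (S.ξ x) v = 0 := by
  rw [S.Φ_skew hε₁, S.Φ_ξ_right hε₁, neg_zero]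

variable [FiniteDimensional ℝ E]

/-- The second covariant derivative `(∇²_{u, V} φ) Y`. -/
def covcovφ {p : M} (u : TangentSpace 𝓘(ℝ, E) p) (V Y : Π x : M, TangentSpace 𝓘(ℝ, E) x) :
    TangentSpace 𝓘(ℝ, E) p :=
  S.g.leviCivita (fun y ↦ S.covφ y (Y y) (V y)) p u - S.covφ p (Y p) (S.g.leviCivita V p u)
    - S.covφ p (S.g.leviCivita Y p u) (V p)

/-- The second covariant derivative `(∇²_{u, V} η) X`. -/
def covcovη {p : M} (u : TangentSpace 𝓘(ℝ, E) p) (V X : Π x : M, TangentSpace 𝓘(ℝ, E) x) : ℝ :=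
  ε₀ * S.g.inner p (S.g.leviCivita (fun y ↦ S.g.leviCivita S.ξ y (V y)) p u
    - S.g.leviCivita S.ξ p (S.g.leviCivita V p u)) (X p)

section

variable {p : M} {U V X Y : Π x : M, TangentSpace 𝓘(ℝ, E) x} (u : TangentSpace 𝓘(ℝ, E) p)

theorem covφ_eventuallyEq (hY : CMDiffAt 2 (T% Y) p) :
    (fun y ↦ S.covφ y (Y y) (V y)) =ᶠ[𝓝 p] fun y ↦ S.g.leviCivita (S.φField Y) y (V y)
      - S.φField (fun y ↦ S.g.leviCivita Y y (V y)) y := by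
  filter_upwards [eventually_mdifferentiableAt hY] with y hy
  exact S.covφ_apply hy _

theorem mdifferentiableAt_covφ (hV : CMDiffAt 2 (T% V) p) (hY : CMDiffAt 2 (T% Y) p) :
    MDiffAt (T% (fun y ↦ S.covφ y (Y y) (V y))) p := by
  refine (mdifferentiableAt_sub_section
    (S.g.mdifferentiableAt_leviCivita hV (S.contMDiffAt_φField hY)) (S.mdifferentiableAt_φField
      (S.g.mdifferentiableAt_leviCivita hV hY))).congr_of_eventuallyEq ?_
  filter_upwards [S.covφ_eventuallyEq (V := V) hY] with y hy
  rw [hy]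
  rfl

theorem hasDerivAlong_inner (hX : MDiffAt (T% X) p) (hY : MDiffAt (T% Y) p) :
    HasDerivAlong (fun y ↦ S.g.inner y (X y) (Y y)) p u
      (S.g.inner p (S.g.leviCivita X p u) (Y p) + S.g.inner p (X p) (S.g.leviCivita Y p u)) :=
  ⟨S.g.mdifferentiableAt_inner hX hY, S.mvfderiv_inner_eq' hX hY u⟩

theorem hasDerivAlong_covΦTensor (hV : CMDiffAt 2 (T% V) p) (hX : CMDiffAt 2 (T% X) p)
    (hY : CMDiffAt 2 (T% Y) p) :
    HasDerivAlong (fun y ↦ S.covΦTensor y (V y) (X y) (Y y)) p u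
      (S.g.inner p (X p) (S.covcovφ u V Y) + S.covΦTensor p (S.g.leviCivita V p u) (X p) (Y p)
      + S.covΦTensor p (V p) (S.g.leviCivita X p u) (Y p)
      + S.covΦTensor p (V p) (X p) (S.g.leviCivita Y p u)) := by
  convert! S.hasDerivAlong_inner u (hX.mdifferentiableAt (by norm_num))
    (S.mdifferentiableAt_covφ hV hY) using 1
  simp only [covcovφ, covΦTensor, map_sub]
  ring

theorem hasDerivAlong_covη (hV : CMDiffAt 2 (T% V) p) (hX : MDiffAt (T% X) p) :
    HasDerivAlong (fun y ↦ S.covη y (V y) (X y)) p u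
      (S.covcovη u V X + S.covη p (S.g.leviCivita V p u) (X p)
      + S.covη p (V p) (S.g.leviCivita X p u)) := by
  convert! (S.hasDerivAlong_inner u
    (S.g.mdifferentiableAt_leviCivita hV (S.contMDiffAt_ξ p)) hX).const_mul ε₀ using 1
  simp only [covcovη, covη, map_sub, _root_.sub_apply]
  ring

theorem hasDerivAlong_Φ (hX : MDiffAt (T% X) p) (hY : MDiffAt (T% Y) p) :
    HasDerivAlong (fun y ↦ S.Φ y (X y) (Y y)) p u
      (S.covΦTensor p u (X p) (Y p) + S.Φ p (S.g.leviCivita X p u) (Y p)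
      + S.Φ p (X p) (S.g.leviCivita Y p u)) := by
  convert! S.hasDerivAlong_inner u hX (S.mdifferentiableAt_φField hY) using 1
  simp only [covΦTensor, S.covφ_apply hY, Φ, map_sub, φField]
  ring

theorem hasDerivAlong_η (hε₀ : ε₀ ^ 2 = 1) (hε₁ : ε₁ ^ 2 = 1) (hY : MDiffAt (T% Y) p) :
    HasDerivAlong (fun y ↦ S.η y (Y y)) p u
      (S.covη p u (Y p) + S.η p (S.g.leviCivita Y p u)) :=
  S.mvfderiv_η_eq u hε₀ hε₁ hY

theorem leviCivita_φField (hY : MDiffAt (T% Y) p) :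
    S.g.leviCivita (S.φField Y) p u = S.covφ p (Y p) u + S.φ p (S.g.leviCivita Y p u) := by
  rw [S.covφ_apply hY, sub_add_cancel]

/-- The Ricci identity for `φ`. -/
theorem covcovφ_sub_swap (hU : CMDiffAt 2 (T% U) p) (hV : CMDiffAt 2 (T% V) p)
    (hY : CMDiffAt 2 (T% Y) p) :
    S.covcovφ (U p) V Y - S.covcovφ (V p) U Y =
      S.g.curvature U V (S.φField Y) p - S.φ p (S.g.curvature U V Y p) := by
  have md {X : Π x : M, TangentSpace 𝓘(ℝ, E) x} (hX : CMDiffAt 2 (T% X) p) :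
    MDiffAt (T% X) p := hX.mdifferentiableAt (by norm_num)
  have key {U V : Π x : M, TangentSpace 𝓘(ℝ, E) x} (hU : CMDiffAt 2 (T% U) p)
      (hV : CMDiffAt 2 (T% V) p) : S.covcovφ (U p) V Y =
      S.g.leviCivita (fun y ↦ S.g.leviCivita (S.φField Y) y (V y)) p (U p)
      - S.φ p (S.g.leviCivita (fun y ↦ S.g.leviCivita Y y (V y)) p (U p))
      - S.covφ p (S.g.leviCivita Y p (V p)) (U p)
      - S.covφ p (S.g.leviCivita Y p (U p)) (V p)
      - S.g.leviCivita (S.φField Y) p (S.g.leviCivita V p (U p))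
      + S.φ p (S.g.leviCivita Y p (S.g.leviCivita V p (U p))) := by
    have hd := S.g.mdifferentiableAt_leviCivita hV hY
    have hdφ := S.g.mdifferentiableAt_leviCivita hV (S.contMDiffAt_φField hY)
    rw [covcovφ, S.g.leviCivita.congr_of_eventuallyEq (S.mdifferentiableAt_covφ hV hY)
      (mdifferentiableAt_sub_section hdφ (S.mdifferentiableAt_φField hd))
      (S.covφ_eventuallyEq hY)]
    change S.g.leviCivita (fun y ↦ S.g.leviCivita (S.φField Y) y (V y) -
      S.φField (fun y ↦ S.g.leviCivita Y y (V y)) y) p (U p) - _ - _ = _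
    rw [S.g.leviCivita_sub hdφ (S.mdifferentiableAt_φField hd), _root_.sub_apply,
      S.leviCivita_φField _ hd, S.covφ_apply (md hY)]
    abel
  rw [key hU hV, key hV hU]
  simp only [PseudoRiemannianMetric.curvature, ← S.g.leviCivita_sub_swap (md hU) (md hV), map_sub]
  abel

/-- The Ricci identity for `η`. -/
theorem covcovη_sub_swap (hU : MDiffAt (T% U) p) (hV : MDiffAt (T% V) p) :
    S.covcovη (U p) V X - S.covcovη (V p) U X = ε₀ * S.g.riemann U V S.ξ X p := by
  simp only [covcovη, PseudoRiemannianMetric.riemann, PseudoRiemannianMetric.curvature,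
    ← S.g.leviCivita_sub_swap hU hV, map_sub, _root_.sub_apply]
  ring

end

section

variable {S} {p : M} {U V X Y : Π x : M, TangentSpace 𝓘(ℝ, E) x} (u v w : TangentSpace 𝓘(ℝ, E) p)

/-- The derivative of `covη_sub_swap`; the terms in ∇_uX and ∇_uY drop out by the same identity at
`p`. -/
theorem IsParaContact.covcovη_sub_swap_right (hS : S.IsParaContact) (hε₀ : ε₀ ^ 2 = 1)
    (hε₁ : ε₁ ^ 2 = 1) (hX : CMDiffAt 2 (T% X) p) (hY : CMDiffAt 2 (T% Y) p) :
    S.covcovη u X Y - S.covcovη u Y X = 2 * S.covΦTensor p u (X p) (Y p) := by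
  have hX1 : MDiffAt (T% X) p := hX.mdifferentiableAt (by norm_num)
  have hY1 : MDiffAt (T% Y) p := hY.mdifferentiableAt (by norm_num)
  have h := (S.hasDerivAlong_covη u hX hY1).unique
    ((S.hasDerivAlong_covη u hY hX1).add ((S.hasDerivAlong_Φ u hX1 hY1).const_mul 2))
    (fun y ↦ by linarith [hS.covη_sub_swap (X y) (Y y) hε₀ hε₁])
  have h1 := hS.covη_sub_swap (S.g.leviCivita X p u) (Y p) hε₀ hε₁
  have h2 := hS.covη_sub_swap (X p) (S.g.leviCivita Y p u) hε₀ hε₁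
  linarith

/-- The fundamental form is closed. -/
theorem IsParaContact.covΦTensor_cyclic (hS : S.IsParaContact) (hε₀ : ε₀ ^ 2 = 1)
    (hε₁ : ε₁ ^ 2 = 1) :
    S.covΦTensor p u v w + S.covΦTensor p v w u + S.covΦTensor p w u v = 0 := by
  have hex (v : TangentSpace 𝓘(ℝ, E) p) : ∃ X : Π x : M, TangentSpace 𝓘(ℝ, E) x,
      CMDiffAt 2 (T% X) p ∧ X p = v :=
    ⟨FiberBundle.extend E v, FiberBundle.contMDiffAt_extend .., by simp⟩
  obtain ⟨U, hU, rfl⟩ := hex u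
  obtain ⟨V, hV, rfl⟩ := hex v
  obtain ⟨W, hW, rfl⟩ := hex w
  have md {X : Π x : M, TangentSpace 𝓘(ℝ, E) x} (hX : CMDiffAt 2 (T% X) p) :
    MDiffAt (T% X) p := hX.mdifferentiableAt (by norm_num)
  have a1 := hS.covcovη_sub_swap_right (U p) hε₀ hε₁ hV hW
  have a2 := hS.covcovη_sub_swap_right (V p) hε₀ hε₁ hW hU
  have a3 := hS.covcovη_sub_swap_right (W p) hε₀ hε₁ hU hV
  have b1 := S.covcovη_sub_swap (X := W) (md hU) (md hV)
  have b2 := S.covcovη_sub_swap (X := U) (md hV) (md hW)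
  have b3 := S.covcovη_sub_swap (X := V) (md hW) (md hU)
  have hξ := S.contMDiffAt_ξ p
  rw [S.g.riemann_skew hU hV hξ hW] at b1
  rw [S.g.riemann_skew hV hW hξ hU] at b2
  rw [S.g.riemann_skew hW hU hξ hV] at b3
  have B := congrArg (fun v ↦ S.g.inner p v (S.ξ p)) (S.g.curvature_cyclic hU hV hW)
  simp only [map_add, map_zero, _root_.add_apply, _root_.zero_apply] at B
  simp only [PseudoRiemannianMetric.riemann] at b1 b2 b3
  -- Regrouped, the cyclic sum of ∇Φ is a cyclic sum of commutators of second derivatives of η,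
  -- which vanishes by the first Bianchi identity paired with ξ.
  linear_combination (-1 / 2) * (a1 + a2 + a3) + (1 / 2) * (b1 + b2 + b3) - (ε₀ / 2) * B

end

end AlmostParaContactMetricStructure

/-! ### Moving φ through ∇Φ and ∇η, and the derived second-order identities -/

namespace AlmostParaContactMetricStructure

open Filter Topology

variable {ε₀ ε₁ : ℝ} {E : Type*} [NormedAddCommGroup E] [NormedSpace ℝ E] [FiniteDimensional ℝ E]
  {M : Type*} [TopologicalSpace M] [ChartedSpace E M] [IsManifold 𝓘(ℝ, E) ∞ M]
  {S : AlmostParaContactMetricStructure ε₀ ε₁ E M}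

section

variable {p : M} (u v w : TangentSpace 𝓘(ℝ, E) p)

namespace IsParaContact

theorem covΦTensor_φ_left (hS : S.IsParaContact) (hε₀ : ε₀ ^ 2 = 1) (hε₁ : ε₁ ^ 2 = 1) :
    S.covΦTensor p (S.φ p u) v w = S.covΦTensor p u v (S.φ p w)
      + ε₀ * ε₁ * (2 * S.η p v * S.Φ p u w + S.η p w * S.covη p v u) := by
  -- Closedness at `(φu, v, w)`, with φ moved across the form by `covΦTensor_φ_right`.
  have I (u v w : TangentSpace 𝓘(ℝ, E) p) : S.covΦTensor p (S.φ p u) v w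
      + S.covΦTensor p v w (S.φ p u) + S.covΦTensor p w u (S.φ p v)
      + ε₀ * ε₁ * (S.covη p w v * S.η p u + S.η p v * S.covη p w u) = 0 := by
    have h1 := hS.covΦTensor_cyclic (S.φ p u) v w hε₀ hε₁
    have h2 := S.covΦTensor_skew w (S.φ p u) v hε₁
    have h3 := S.covΦTensor_φ_right w v u hε₀ hε₁
    have h4 := S.covΦTensor_skew w (S.φ p v) u hε₁
    linear_combination h1 - h2 + h3 + h4
  have K (u v w : TangentSpace 𝓘(ℝ, E) p) : S.covΦTensor p (S.φ p u) (S.φ p v) (S.φ p w)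
      = ε₁ * S.covΦTensor p (S.φ p u) v w
        - ε₀ * ε₁ * S.η p w * S.covη p (S.φ p u) (S.φ p v)
        + ε₀ * ε₁ * S.η p v * S.covη p (S.φ p u) (S.φ p w) := by
    have h1 := S.covΦTensor_φ_right (S.φ p u) v (S.φ p w) hε₀ hε₁
    have h2 := S.covΦTensor_ξ_right (S.φ p u) v hε₀ hε₁
    rw [S.η_φ _ hε₁] at h1
    simp only [covΦTensor, S.φ_φ, map_smul, map_sub, _root_.smul_apply, _root_.sub_apply,
      smul_eq_mul] at h1 h2 ⊢
    linear_combination -h1 - ε₁ * S.η p w * h2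
  have C := hS.covΦTensor_cyclic (S.φ p u) (S.φ p v) (S.φ p w) hε₀ hε₁
  have h0 : ε₁ ≠ 0 := by rintro rfl; norm_num at hε₁
  -- Closedness at `(φu, φv, φw)`, stripped of two φ's by `K`, evaluates the cyclic sum of the
  -- derivatives in the φ-directions.
  have C' : S.covΦTensor p (S.φ p u) v w + S.covΦTensor p (S.φ p v) w u
      + S.covΦTensor p (S.φ p w) u v
      + ε₀ * (S.η p v * S.covη p (S.φ p u) (S.φ p w) - S.η p w * S.covη p (S.φ p u) (S.φ p v)
      + (S.η p w * S.covη p (S.φ p v) (S.φ p u) - S.η p u * S.covη p (S.φ p v) (S.φ p w))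
      + (S.η p u * S.covη p (S.φ p w) (S.φ p v) - S.η p v * S.covη p (S.φ p w) (S.φ p u))) = 0 := by
    rw [K, K, K] at C
    apply mul_left_cancel₀ h0
    linear_combination C
  have n1 := hS.covη_sub_swap (S.φ p u) (S.φ p v) hε₀ hε₁
  have n2 := hS.covη_sub_swap (S.φ p v) (S.φ p w) hε₀ hε₁
  have n3 := hS.covη_sub_swap (S.φ p w) (S.φ p u) hε₀ hε₁
  rw [S.Φ_φ_φ hε₁] at n1 n2 n3
  have m1 := hS.covη_sub_swap v u hε₀ hε₁
  have m2 := hS.covη_sub_swap v w hε₀ hε₁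
  have m3 := hS.covη_sub_swap u w hε₀ hε₁
  rw [S.Φ_skew hε₁ w u] at n3
  rw [S.Φ_skew hε₁ v u] at m1
  -- The cyclic sum of `I` has each derivative in a φ-direction once and each with φ in the last
  -- slot twice. Subtracting half of it and adding half of `C'` isolates the two wanted terms.
  linear_combination I u v w - (1 / 2) * (I u v w + I v w u + I w u v)
    + (1 / 2) * (C' + ε₀ * (S.η p w * n1 + S.η p u * n2 + S.η p v * n3))
    + (1 / 2) * ε₀ * ε₁ * (-S.η p w * m1 + S.η p v * m3 + S.η p u * m2)

theorem covη_ξ_left (hS : S.IsParaContact) (hε₀ : ε₀ ^ 2 = 1) (hε₁ : ε₁ ^ 2 = 1) :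
    S.covη p (S.ξ p) v = 0 := by
  have h1 := hS.covη_sub_swap (S.ξ p) v hε₀ hε₁
  rw [S.covη_ξ _ hε₁, S.Φ_ξ_left hε₁] at h1
  linarith

/-- The case w = ξ of `covΦTensor_φ_left`, where ∇Φ reduces to ∇η. -/
theorem covη_φ_φ (hS : S.IsParaContact) (hε₀ : ε₀ ^ 2 = 1) (hε₁ : ε₁ ^ 2 = 1) :
    S.covη p (S.φ p u) (S.φ p v) = ε₁ * S.covη p v u := by
  have h1 := hS.covΦTensor_φ_left u v (S.ξ p) hε₀ hε₁
  rw [S.φ_ξ hε₁, S.covΦTensor_ξ_right _ _ hε₀ hε₁, S.η_ξ, S.Φ_ξ_right hε₁] at h1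
  simp only [covΦTensor, map_zero, _root_.zero_apply] at h1
  linear_combination ε₀ * h1 + (ε₁ * S.covη p v u - S.covη p (S.φ p u) (S.φ p v)) * hε₀

theorem covη_φ_left (hS : S.IsParaContact) (hε₀ : ε₀ ^ 2 = 1) (hε₁ : ε₁ ^ 2 = 1) :
    S.covη p (S.φ p u) v = S.covη p (S.φ p v) u := by
  have h1 := hS.covη_φ_φ u (S.φ p v) hε₀ hε₁
  have h2 := S.covη_ξ (S.φ p u) hε₁
  simp only [covη, S.φ_φ, map_smul, map_sub, smul_eq_mul] at h1 h2 ⊢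
  linear_combination ε₁ * h1 + ε₁ ^ 2 * S.η p v * h2 +
    ε₀ * (S.g.inner p (S.g.leviCivita S.ξ p (S.φ p v)) u
      - S.g.inner p (S.g.leviCivita S.ξ p (S.φ p u)) v) * hε₁

theorem covΦTensor_φ_left_right (hS : S.IsParaContact) (hε₀ : ε₀ ^ 2 = 1) (hε₁ : ε₁ ^ 2 = 1) :
    S.covΦTensor p (S.φ p u) v (S.φ p w) = ε₁ * S.covΦTensor p u v w
      - ε₀ * ε₁ * S.η p w * S.covη p u (S.φ p v)
      + 2 * ε₀ * ε₁ * S.η p v * S.Φ p u (S.φ p w) := by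
  have h1 := hS.covΦTensor_φ_left u v (S.φ p w) hε₀ hε₁
  have h2 := S.covΦTensor_ξ_right u v hε₀ hε₁
  rw [S.η_φ _ hε₁] at h1
  simp only [covΦTensor, S.φ_φ, map_smul, map_sub, _root_.smul_apply, _root_.sub_apply,
    smul_eq_mul] at h1 h2 ⊢
  linear_combination h1 - ε₁ * S.η p w * h2

theorem covΦTensor_ξ_left (hS : S.IsParaContact) (hε₀ : ε₀ ^ 2 = 1) (hε₁ : ε₁ ^ 2 = 1) :
    S.covΦTensor p (S.ξ p) v w = 0 := by
  have h1 := hS.covΦTensor_φ_left_right (S.ξ p) v w hε₀ hε₁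
  rw [S.φ_ξ hε₁, S.Φ_ξ_left hε₁, hS.covη_ξ_left _ hε₀ hε₁] at h1
  simp only [covΦTensor, map_zero] at h1 ⊢
  linear_combination -ε₁ * h1 - S.g.inner p v (S.covφ p w (S.ξ p)) * hε₁

/-- Vector form of `covΦTensor_φ_left`, with φ moved outside ∇φ; nondegeneracy of the metric removes
the test vector. -/
theorem covφ_φ_left (hS : S.IsParaContact) (hε₀ : ε₀ ^ 2 = 1) (hε₁ : ε₁ ^ 2 = 1) :
    S.covφ p w (S.φ p u) = -S.φ p (S.covφ p w u) + (2 * ε₀ * ε₁ * S.η p w) • S.φ p u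
      + (ε₁ * (2 * S.Φ p u w - S.covη p u w)) • S.ξ p := by
  rw [← sub_eq_zero]
  refine S.g.nondegenerate p _ fun v ↦ ?_
  rw [S.g.symm]
  simp only [map_sub, map_add, map_neg, map_smul, smul_eq_mul, S.inner_ξ _ hε₁]
  have h1 := hS.covΦTensor_φ_left u v w hε₀ hε₁
  have h2 := S.covΦTensor_φ_right u v w hε₀ hε₁
  have h3 := hS.covη_sub_swap v u hε₀ hε₁
  have h4 := S.inner_φ_right v (S.covφ p w u) hε₁
  simp only [covΦTensor, Φ] at h1 h2 h3 ⊢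
  linear_combination h1 + h2 + h4 + ε₀ * ε₁ * S.η p w * h3

end IsParaContact

end

section

variable {p : M} {V X Y : Π x : M, TangentSpace 𝓘(ℝ, E) x} (u : TangentSpace 𝓘(ℝ, E) p)

namespace IsParaContact

/-- The derivative of `covΦTensor_φ_left`. Terms in which ∇_u falls on one of the fields cancel by
the identity itself (`h1`, `h2`, `h3`), leaving a tensorial relation. The next two lemmas
differentiate `covΦTensor_φ_left_right` and `covη_φ_left` in the same way. -/
theorem inner_covcovφ_φ_left (hS : S.IsParaContact) (hε₀ : ε₀ ^ 2 = 1) (hε₁ : ε₁ ^ 2 = 1)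
    (hV : CMDiffAt 2 (T% V) p) (hX : CMDiffAt 2 (T% X) p) (hY : CMDiffAt 2 (T% Y) p) :
    S.g.inner p (X p) (S.covcovφ u (S.φField V) Y) + S.covΦTensor p (S.covφ p (V p) u) (X p) (Y p)
      - S.g.inner p (X p) (S.covcovφ u V (S.φField Y))
      - S.covΦTensor p (V p) (X p) (S.covφ p (Y p) u) =
    ε₀ * ε₁ * (2 * S.covη p u (X p) * S.Φ p (V p) (Y p)
      + 2 * S.η p (X p) * S.covΦTensor p u (V p) (Y p)
      + S.covη p u (Y p) * S.covη p (X p) (V p) + S.η p (Y p) * S.covcovη u X V) := by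
  have md {X : Π x : M, TangentSpace 𝓘(ℝ, E) x} (hX : CMDiffAt 2 (T% X) p) :
    MDiffAt (T% X) p := hX.mdifferentiableAt (by norm_num)
  have h := (S.hasDerivAlong_covΦTensor u (S.contMDiffAt_φField hV) hX hY).unique
    ((S.hasDerivAlong_covΦTensor u hV hX (S.contMDiffAt_φField hY)).add
      (((((S.hasDerivAlong_η u hε₀ hε₁ (md hX)).const_mul 2).mul
        (S.hasDerivAlong_Φ u (md hV) (md hY))).add
      ((S.hasDerivAlong_η u hε₀ hε₁ (md hY)).mul
        (S.hasDerivAlong_covη u hX (md hV)))).const_mul (ε₀ * ε₁)))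
    (fun y ↦ hS.covΦTensor_φ_left (V y) (X y) (Y y) hε₀ hε₁)
  have h1 := hS.covΦTensor_φ_left (S.g.leviCivita V p u) (X p) (Y p) hε₀ hε₁
  have h2 := hS.covΦTensor_φ_left (V p) (S.g.leviCivita X p u) (Y p) hε₀ hε₁
  have h3 := hS.covΦTensor_φ_left (V p) (X p) (S.g.leviCivita Y p u) hε₀ hε₁
  rw [S.leviCivita_φField u (md hV), S.leviCivita_φField u (md hY)] at h
  simp only [covΦTensor, φField, map_add, _root_.add_apply] at h h1 h2 h3 ⊢
  linear_combination h - h1 - h2 - h3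

theorem inner_covcovφ_φ_left_right (hS : S.IsParaContact) (hε₀ : ε₀ ^ 2 = 1) (hε₁ : ε₁ ^ 2 = 1)
    (hV : CMDiffAt 2 (T% V) p) (hX : CMDiffAt 2 (T% X) p) (hY : CMDiffAt 2 (T% Y) p) :
    S.g.inner p (X p) (S.covcovφ u (S.φField V) (S.φField Y))
      + S.covΦTensor p (S.covφ p (V p) u) (X p) (S.φ p (Y p))
      + S.covΦTensor p (S.φ p (V p)) (X p) (S.covφ p (Y p) u)
      - ε₁ * S.g.inner p (X p) (S.covcovφ u V Y) =
    -ε₀ * ε₁ * (S.covη p u (Y p) * S.covη p (V p) (S.φ p (X p))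
        + S.η p (Y p) * S.covcovη u V (S.φField X)
        + S.η p (Y p) * S.covη p (V p) (S.covφ p (X p) u))
      + 2 * ε₀ * ε₁ * (S.covη p u (X p) * S.Φ p (V p) (S.φ p (Y p))
        + S.η p (X p) * (S.covΦTensor p u (V p) (S.φ p (Y p))
          + S.Φ p (V p) (S.covφ p (Y p) u))) := by
  have md {X : Π x : M, TangentSpace 𝓘(ℝ, E) x} (hX : CMDiffAt 2 (T% X) p) :
    MDiffAt (T% X) p := hX.mdifferentiableAt (by norm_num)
  have h := (S.hasDerivAlong_covΦTensor u (S.contMDiffAt_φField hV) hX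
      (S.contMDiffAt_φField hY)).unique
    ((((S.hasDerivAlong_covΦTensor u hV hX hY).const_mul ε₁).add
      (((S.hasDerivAlong_η u hε₀ hε₁ (md hY)).mul
        (S.hasDerivAlong_covη u hV (S.mdifferentiableAt_φField (md hX)))).const_mul
        (-(ε₀ * ε₁)))).add
      (((S.hasDerivAlong_η u hε₀ hε₁ (md hX)).mul
        (S.hasDerivAlong_Φ u (md hV) (S.mdifferentiableAt_φField (md hY)))).const_mul
        (2 * ε₀ * ε₁)))
    (fun y ↦ by
      have := hS.covΦTensor_φ_left_right (V y) (X y) (Y y) hε₀ hε₁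
      simp only [φField]
      linear_combination this)
  have h1 := hS.covΦTensor_φ_left_right (S.g.leviCivita V p u) (X p) (Y p) hε₀ hε₁
  have h2 := hS.covΦTensor_φ_left_right (V p) (S.g.leviCivita X p u) (Y p) hε₀ hε₁
  have h3 := hS.covΦTensor_φ_left_right (V p) (X p) (S.g.leviCivita Y p u) hε₀ hε₁
  rw [S.leviCivita_φField u (md hV), S.leviCivita_φField u (md hY),
    S.leviCivita_φField u (md hX)] at h
  simp only [covΦTensor, covη, Φ, φField, map_add, _root_.add_apply] at h h1 h2 h3 ⊢
  linear_combination h - h1 - h2 - h3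

theorem covcovη_φ_left (hS : S.IsParaContact) (hε₀ : ε₀ ^ 2 = 1) (hε₁ : ε₁ ^ 2 = 1)
    (hX : CMDiffAt 2 (T% X) p) (hY : CMDiffAt 2 (T% Y) p) :
    S.covcovη u (S.φField X) Y + S.covη p (S.covφ p (X p) u) (Y p) =
      S.covcovη u (S.φField Y) X + S.covη p (S.covφ p (Y p) u) (X p) := by
  have md {X : Π x : M, TangentSpace 𝓘(ℝ, E) x} (hX : CMDiffAt 2 (T% X) p) :
    MDiffAt (T% X) p := hX.mdifferentiableAt (by norm_num)
  have h := (S.hasDerivAlong_covη u (S.contMDiffAt_φField hX) (md hY)).unique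
    (S.hasDerivAlong_covη u (S.contMDiffAt_φField hY) (md hX))
    (fun y ↦ hS.covη_φ_left (X y) (Y y) hε₀ hε₁)
  have h1 := hS.covη_φ_left (S.g.leviCivita X p u) (Y p) hε₀ hε₁
  have h2 := hS.covη_φ_left (S.g.leviCivita Y p u) (X p) hε₀ hε₁
  rw [S.leviCivita_φField u (md hX), S.leviCivita_φField u (md hY)] at h
  simp only [covη, φField, map_add, _root_.add_apply] at h h1 h2 ⊢
  linear_combination h - h1 + h2

end IsParaContact

end

end AlmostParaContactMetricStructure

/-! ### Orthonormal frames -/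

namespace PseudoRiemannianMetric

variable {E : Type*} [NormedAddCommGroup E] [NormedSpace ℝ E] [FiniteDimensional ℝ E]
  {M : Type*} [TopologicalSpace M] [ChartedSpace E M] [IsManifold 𝓘(ℝ, E) ∞ M]
  (g : PseudoRiemannianMetric E M)

/-- Expansion of the inner product in an orthonormal frame. -/
theorem sum_inner_mul_inner {ι : Type*} [Fintype ι] {p : M} (e : ι → TangentSpace 𝓘(ℝ, E) p)
    (hι : Fintype.card ι = Module.finrank ℝ E)
    (he_orthogonal : ∀ i j, i ≠ j → g.inner p (e i) (e j) = 0)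
    (he_unit : ∀ i, g.inner p (e i) (e i) = 1 ∨ g.inner p (e i) (e i) = -1)
    (v w : TangentSpace 𝓘(ℝ, E) p) :
    ∑ i, g.inner p (e i) (e i) * g.inner p v (e i) * g.inner p w (e i) = g.inner p v w := by
  classical
  have hsq (i : ι) : g.inner p (e i) (e i) * g.inner p (e i) (e i) = 1 := by
    rcases he_unit i with h | h <;> rw [h] <;> norm_num
  have hsum (c : ι → ℝ) (j : ι) :
      g.inner p (∑ i, c i • e i) (e j) = c j * g.inner p (e j) (e j) := by
    rw [map_sum, _root_.sum_apply, Finset.sum_eq_single j]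
    · simp
    · intro i _ hij
      simp [he_orthogonal i j hij]
    · simp
  have hli : LinearIndependent ℝ e := by
    rw [Fintype.linearIndependent_iff]
    intro c hc j
    have := hsum c j
    rw [hc] at this
    have h2 := hsq j
    simp only [map_zero, _root_.zero_apply] at this
    linear_combination -g.inner p (e j) (e j) * this - c j * h2
  have : FiniteDimensional ℝ (TangentSpace 𝓘(ℝ, E) p) := inferInstanceAs (FiniteDimensional ℝ E)
  have hspan : Submodule.span ℝ (Set.range e) = ⊤ :=
    hli.span_eq_top_of_card_eq_finrank' hι
  have hv : ∃ c : ι → ℝ, ∑ i, c i • e i = v := by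
    have : v ∈ Submodule.span ℝ (Set.range e) := hspan ▸ Submodule.mem_top
    exact (Submodule.mem_span_range_iff_exists_fun ℝ).1 this
  obtain ⟨c, rfl⟩ := hv
  have hR : g.inner p (∑ i, c i • e i) w = ∑ i, c i * g.inner p w (e i) := by
    rw [map_sum, _root_.sum_apply]
    simp [g.symm p w]
  rw [hR]
  refine Finset.sum_congr rfl fun i _ ↦ ?_
  rw [hsum]
  linear_combination (c i * g.inner p w (e i)) * hsq i

end PseudoRiemannianMetric

/-! ### Cancellation of the second-order terms -/

namespace AlmostParaContactMetricStructure

open Filter Topology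

variable {ε₀ ε₁ : ℝ} {E : Type*} [NormedAddCommGroup E] [NormedSpace ℝ E] [FiniteDimensional ℝ E]
  {M : Type*} [TopologicalSpace M] [ChartedSpace E M] [IsManifold 𝓘(ℝ, E) ∞ M]
  {S : AlmostParaContactMetricStructure ε₀ ε₁ E M}

theorem eq_one_or_eq_neg_one_of_sq {a : ℝ} (h : a ^ 2 = 1) : a = 1 ∨ a = -1 := by
  rwa [sq, mul_self_eq_one_iff] at h

section

variable {p : M} (x y z w : TangentSpace 𝓘(ℝ, E) p)

theorem η_covφ (hε₀ : ε₀ ^ 2 = 1) (hε₁ : ε₁ ^ 2 = 1) :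
    S.η p (S.covφ p w z) = -S.covη p z (S.φ p w) := by
  have h1 := S.covΦTensor_ξ_right z w hε₀ hε₁
  rw [S.covΦTensor_skew _ _ _ hε₁, covΦTensor, S.g.symm, S.inner_ξ _ hε₁] at h1
  linear_combination -ε₀ * h1 - (S.η p (S.covφ p w z) + S.covη p z (S.φ p w)) * hε₀

namespace IsParaContact

/-- This and the next three lemmas insert `covφ_φ_left` into the first-order terms met in
`half_curvature`. In the first three the ξ-component of ∇_{φz}φ is lost, since Φ(·,ξ), ∇_ξη and ∇_ξΦ
vanish. -/
theorem Φ_covφ_φ_left (hS : S.IsParaContact) (hε₀ : ε₀ ^ 2 = 1) (hε₁ : ε₁ ^ 2 = 1) :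
    S.Φ p x (S.covφ p w (S.φ p z)) = -ε₁ * S.covΦTensor p z x w
      - ε₀ * ε₁ * S.η p x * S.covη p z (S.φ p w)
      + 2 * ε₀ * S.η p w * (S.g.inner p x z - ε₀ * S.η p x * S.η p z) := by
  have h1 := S.Φ_φ_right hε₁ x (S.covφ p w z)
  have h2 := S.Φ_φ_right hε₁ x z
  have h3 := S.Φ_ξ_right hε₁ x
  have h4 := S.η_covφ z w hε₀ hε₁
  rw [hS.covφ_φ_left _ _ hε₀ hε₁]
  simp only [Φ, covΦTensor, map_add, map_neg, map_smul, smul_eq_mul] at *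
  linear_combination -h1 + 2 * ε₀ * ε₁ * S.η p w * h2 + ε₁ * (2 * S.g.inner p z (S.φ p w) -
    S.covη p z w) * h3 + ε₀ * ε₁ * S.η p x * h4 + 2 * ε₀ * S.η p w *
    (S.g.inner p x z - ε₀ * S.η p x * S.η p z) * hε₁

theorem covη_covφ_φ_left (hS : S.IsParaContact) (hε₀ : ε₀ ^ 2 = 1) (hε₁ : ε₁ ^ 2 = 1) :
    S.covη p (S.covφ p x (S.φ p z)) y = -S.covη p (S.φ p y) (S.covφ p x z)
      + 2 * ε₀ * ε₁ * S.η p x * S.covη p (S.φ p z) y := by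
  have h1 := hS.covη_φ_left (S.covφ p x z) y hε₀ hε₁
  have h2 := hS.covη_ξ_left y hε₀ hε₁
  rw [hS.covφ_φ_left _ _ hε₀ hε₁]
  simp only [covη, map_add, map_neg, map_smul, smul_eq_mul, _root_.add_apply, _root_.neg_apply,
    _root_.smul_apply] at h1 h2 ⊢
  linear_combination -h1 + (ε₁ * (2 * S.Φ p z x -
    ε₀ * S.g.inner p (S.g.leviCivita S.ξ p z) x)) * h2

theorem covΦTensor_covφ_φ_left (hS : S.IsParaContact) (hε₀ : ε₀ ^ 2 = 1) (hε₁ : ε₁ ^ 2 = 1) :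
    S.covΦTensor p (S.covφ p x (S.φ p z)) y (S.φ p w) =
      -ε₁ * S.covΦTensor p (S.covφ p x z) y w
      + ε₀ * ε₁ * S.η p w * S.covη p (S.covφ p x z) (S.φ p y)
      - 2 * ε₀ * ε₁ * S.η p y * S.Φ p (S.covφ p x z) (S.φ p w)
      + 2 * ε₀ * ε₁ * S.η p x * S.covΦTensor p (S.φ p z) y (S.φ p w) := by
  have h1 := hS.covΦTensor_φ_left_right (S.covφ p x z) y w hε₀ hε₁
  have h2 := hS.covΦTensor_ξ_left y (S.φ p w) hε₀ hε₁
  rw [hS.covφ_φ_left _ _ hε₀ hε₁]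
  simp only [covΦTensor, map_add, map_neg, map_smul, smul_eq_mul] at h1 h2 ⊢
  linear_combination -h1 + (ε₁ * (2 * S.Φ p z x - S.covη p z x)) * h2

theorem inner_covφ_φ_left_covφ_φ_left (hS : S.IsParaContact) (hε₀ : ε₀ ^ 2 = 1)
    (hε₁ : ε₁ ^ 2 = 1) :
    S.g.inner p (S.covφ p y (S.φ p x)) (S.covφ p w (S.φ p z)) =
      -ε₁ * (S.g.inner p (S.covφ p y x) (S.covφ p w z)
        - ε₀ * S.covη p x (S.φ p y) * S.covη p z (S.φ p w))
      + 2 * ε₀ * S.η p w * (S.covΦTensor p x z y + ε₀ * S.η p z * S.covη p x (S.φ p y))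
      + 2 * ε₀ * S.η p y * (S.covΦTensor p z x w + ε₀ * S.η p x * S.covη p z (S.φ p w))
      - 4 * ε₁ * S.η p y * S.η p w * (S.g.inner p x z - ε₀ * S.η p x * S.η p z)
      + ε₀ * (2 * S.Φ p x y - S.covη p x y) * (2 * S.Φ p z w - S.covη p z w) := by
  have h1 := S.inner_φ_φ p (S.covφ p y x) (S.covφ p w z)
  have h2 := S.inner_φ_φ p (S.covφ p y x) z
  have h3 := S.inner_φ_φ p x (S.covφ p w z)
  have h4 := S.inner_φ_φ p x z
  rw [S.η_covφ _ _ hε₀ hε₁] at h1 h2 h3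
  rw [S.η_covφ _ _ hε₀ hε₁] at h1
  have g1 : S.covΦTensor p x z y = S.g.inner p (S.covφ p y x) z := S.g.symm ..
  have g2 : S.covΦTensor p z x w = S.g.inner p x (S.covφ p w z) := rfl
  have hξ (v : TangentSpace 𝓘(ℝ, E) p) : S.g.inner p (S.φ p v) (S.ξ p) = 0 := by
    rw [S.inner_ξ _ hε₁, S.η_φ _ hε₁, mul_zero]
  have hξ' (v : TangentSpace 𝓘(ℝ, E) p) : S.g.inner p (S.ξ p) (S.φ p v) = 0 := by
    rw [S.g.symm, hξ]
  have hξξ : S.g.inner p (S.ξ p) (S.ξ p) = ε₀ := by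
    rw [S.inner_ξ _ hε₁, S.η_ξ, mul_one]
  rw [hS.covφ_φ_left _ _ hε₀ hε₁, hS.covφ_φ_left _ _ hε₀ hε₁, g1, g2]
  simp only [map_add, map_neg, map_smul, smul_eq_mul, _root_.add_apply, _root_.neg_apply,
    _root_.smul_apply, hξ, hξ', hξξ, h1, h2, h3, h4]
  -- The polynomial identity holds modulo ε₀² = ε₁² = 1; substituting the four sign choices lets
  -- `ring` decide it.
  rcases eq_one_or_eq_neg_one_of_sq hε₀ with rfl | rfl <;> rcases eq_one_or_eq_neg_one_of_sq hε₁ with rfl | rfl <;> ring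

end IsParaContact

end

theorem inner_covcovφ_skew {p : M} {V X Y : Π x : M, TangentSpace 𝓘(ℝ, E) x} (hε₁ : ε₁ ^ 2 = 1)
    (u : TangentSpace 𝓘(ℝ, E) p) (hV : CMDiffAt 2 (T% V) p) (hX : CMDiffAt 2 (T% X) p)
    (hY : CMDiffAt 2 (T% Y) p) :
    S.g.inner p (X p) (S.covcovφ u V Y) = -S.g.inner p (Y p) (S.covcovφ u V X) := by
  have h := (S.hasDerivAlong_covΦTensor u hV hX hY).unique
    ((S.hasDerivAlong_covΦTensor u hV hY hX).const_mul (-1))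
    (fun y ↦ by rw [S.covΦTensor_skew _ _ _ hε₁, neg_one_mul])
  have h1 := S.covΦTensor_skew (S.g.leviCivita V p u) (X p) (Y p) hε₁
  have h2 := S.covΦTensor_skew (V p) (S.g.leviCivita X p u) (Y p) hε₁
  have h3 := S.covΦTensor_skew (V p) (X p) (S.g.leviCivita Y p u) hε₁
  linear_combination h - h1 - h2 - h3

theorem riemann_φ_add {p : M} {U V Y W : Π x : M, TangentSpace 𝓘(ℝ, E) x} (hε₁ : ε₁ ^ 2 = 1)
    (hU : CMDiffAt 2 (T% U) p) (hV : CMDiffAt 2 (T% V) p) (hY : CMDiffAt 2 (T% Y) p) :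
    S.g.riemann U V (S.φField Y) W p + S.g.riemann U V Y (S.φField W) p =
      S.g.inner p (W p) (S.covcovφ (U p) V Y) - S.g.inner p (W p) (S.covcovφ (V p) U Y) := by
  rw [← map_sub, S.covcovφ_sub_swap hU hV hY, map_sub, S.inner_φ_right _ _ hε₁, S.g.symm p (W p),
    S.g.symm p (S.φ p (W p))]
  simp only [PseudoRiemannianMetric.riemann, φField]
  ring

/-- This is `riemann_φ_add` with φW for W; the ξ-part of φ²W produces the term R(U,V,Y,ξ). -/
theorem riemann_φ_φ_add {p : M} {U V Y W : Π x : M, TangentSpace 𝓘(ℝ, E) x} (hε₁ : ε₁ ^ 2 = 1)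
    (hU : CMDiffAt 2 (T% U) p) (hV : CMDiffAt 2 (T% V) p) (hY : CMDiffAt 2 (T% Y) p) :
    ε₁ * S.g.riemann U V Y W p + S.g.riemann U V (S.φField Y) (S.φField W) p =
      S.g.inner p (S.φ p (W p)) (S.covcovφ (U p) V Y)
      - S.g.inner p (S.φ p (W p)) (S.covcovφ (V p) U Y)
      + ε₁ * S.η p (W p) * S.g.riemann U V Y S.ξ p := by
  have h := S.riemann_φ_add (W := S.φField W) hε₁ hU hV hY
  simp only [PseudoRiemannianMetric.riemann, φField, S.φ_φ, map_smul, map_sub, smul_eq_mul] at h ⊢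
  linear_combination h

namespace IsParaContact

/-- The left side collects the second derivatives, of φ and of η, whose outer direction is Z or φZ;
the right side is of first order. The differentiated identities produce g((∇_Xφ)Y, (∇_Zφ)W) twice
with opposite signs, and (∇_{(∇_Zφ)X}Φ)(Y,W) twice with equal signs, hence the leading coefficient
2. -/
theorem half_curvature {p : M} {X Y Z W : Π x : M, TangentSpace 𝓘(ℝ, E) x} (hS : S.IsParaContact)
    (hε₀ : ε₀ ^ 2 = 1) (hε₁ : ε₁ ^ 2 = 1)
    (hX : CMDiffAt 2 (T% X) p) (hY : CMDiffAt 2 (T% Y) p)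
    (hW : CMDiffAt 2 (T% W) p) :
    S.g.inner p (Y p) (S.covcovφ (Z p) X (S.φField W))
      - S.g.inner p (Y p) (S.covcovφ (Z p) (S.φField X) W)
      + ε₁ * (S.g.inner p (Y p) (S.covcovφ (S.φ p (Z p)) (S.φField X) (S.φField W))
      - ε₁ * S.g.inner p (Y p) (S.covcovφ (S.φ p (Z p)) X W))
      + ε₀ * S.η p (W p) * (S.covcovη (S.φ p (Z p)) (S.φField X) Y
        + ε₁ * S.covcovη (Z p) X Y) =
    2 * S.covΦTensor p (S.covφ p (X p) (Z p)) (Y p) (W p)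
      - 2 * ε₀ * ε₁ * S.η p (W p) * (S.covΦTensor p (Z p) (Y p) (X p)
        + ε₀ * S.covη p (Z p) (S.φ p (X p)) * S.η p (Y p))
      + 2 * ε₀ * ε₁ * S.η p (Y p) * (S.covΦTensor p (Z p) (W p) (X p)
        + ε₀ * S.covη p (Z p) (S.φ p (X p)) * S.η p (W p))
      - 2 * ε₀ * S.η p (X p) * (ε₁ * S.covΦTensor p (Z p) (Y p) (W p)
        - ε₀ * ε₁ * S.η p (W p) * S.covη p (Z p) (S.φ p (Y p))
        + 2 * ε₀ * ε₁ * S.η p (Y p) * S.Φ p (Z p) (S.φ p (W p)))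
      + ε₀ * S.covη p (X p) (S.φ p (Y p)) * S.covη p (Z p) (S.φ p (W p))
      + 2 * ε₀ * ε₁ * S.η p (W p) * (S.covΦTensor p (X p) (Z p) (Y p)
        + ε₀ * S.η p (Z p) * S.covη p (X p) (S.φ p (Y p)))
      + 2 * ε₀ * ε₁ * S.η p (Y p) * (S.covΦTensor p (Z p) (X p) (W p)
        + ε₀ * S.η p (X p) * S.covη p (Z p) (S.φ p (W p)))
      - 4 * S.η p (Y p) * S.η p (W p) *
        (S.g.inner p (X p) (Z p) - ε₀ * S.η p (X p) * S.η p (Z p))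
      + ε₀ * ε₁ * (2 * S.Φ p (X p) (Y p) - S.covη p (X p) (Y p)) *
        (2 * S.Φ p (Z p) (W p) - S.covη p (Z p) (W p))
      - ε₀ * ε₁ * (2 * S.covη p (Z p) (Y p) * S.Φ p (X p) (W p)
        + 2 * S.η p (Y p) * S.covΦTensor p (Z p) (X p) (W p)
        + S.covη p (Z p) (W p) * S.covη p (Y p) (X p))
      - ε₀ * S.covη p (S.φ p (Z p)) (W p) * S.covη p (X p) (S.φ p (Y p))
      + 2 * ε₀ * S.covη p (S.φ p (Z p)) (Y p) * S.Φ p (X p) (S.φ p (W p))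
      + 2 * ε₀ * S.η p (Y p) * (ε₁ * S.covΦTensor p (Z p) (X p) (W p)
        - ε₀ * ε₁ * S.η p (W p) * S.covη p (Z p) (S.φ p (X p))
        + 2 * ε₀ * ε₁ * S.η p (X p) * S.Φ p (Z p) (S.φ p (W p))
        - ε₁ * S.covΦTensor p (Z p) (X p) (W p)
        - ε₀ * ε₁ * S.η p (X p) * S.covη p (Z p) (S.φ p (W p))
        + 2 * ε₀ * S.η p (W p) * (S.g.inner p (X p) (Z p) - ε₀ * S.η p (X p) * S.η p (Z p)))
      + ε₀ * S.η p (W p) * (2 * ε₁ * S.covΦTensor p (Z p) (X p) (Y p)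
        - 2 * (ε₁ * S.covΦTensor p (Z p) (X p) (Y p)
          - ε₀ * ε₁ * S.η p (Y p) * S.covη p (Z p) (S.φ p (X p))
          + 2 * ε₀ * ε₁ * S.η p (X p) * S.Φ p (Z p) (S.φ p (Y p)))
        - 2 * (-ε₁ * S.covΦTensor p (Z p) (X p) (Y p)
          - ε₀ * ε₁ * S.η p (X p) * S.covη p (Z p) (S.φ p (Y p))
          + 2 * ε₀ * S.η p (Y p) * (S.g.inner p (X p) (Z p) - ε₀ * S.η p (X p) * S.η p (Z p)))
        - 2 * ε₀ * ε₁ * S.η p (X p) * S.covη p (S.φ p (Z p)) (Y p)) := by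
  -- `e1` and `e2` eliminate ∇²φ. The ∇²η terms left over are matched by `e3` and `e4`, which carry
  -- ∇²_{φZ,φX}η(Y) to ∇²_{φZ,X}η(φY), and by `e5`, which exchanges X and Y.
  have e1 := hS.inner_covcovφ_φ_left (Z p) hε₀ hε₁ hX hY hW
  have e2 := hS.inner_covcovφ_φ_left_right (S.φ p (Z p)) hε₀ hε₁ hX hY hW
  have e3 := hS.covcovη_φ_left (S.φ p (Z p)) hε₀ hε₁ hX hY
  have e4 := hS.covcovη_sub_swap_right (S.φ p (Z p)) hε₀ hε₁ (S.contMDiffAt_φField hY) hX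
  have e5 := hS.covcovη_sub_swap_right (Z p) hε₀ hε₁ hX hY
  have e6 := hS.covη_sub_swap (S.covφ p (Y p) (S.φ p (Z p))) (X p) hε₀ hε₁
  have a1 := hS.covΦTensor_covφ_φ_left (X p) (Y p) (Z p) (W p) hε₀ hε₁
  have a2 := hS.inner_covφ_φ_left_covφ_φ_left (X p) (Y p) (Z p) (W p) hε₀ hε₁
  have a3 := hS.Φ_covφ_φ_left (X p) (Z p) (W p) hε₀ hε₁
  have a4 := hS.Φ_covφ_φ_left (X p) (Z p) (Y p) hε₀ hε₁
  have a5 := hS.covη_covφ_φ_left (X p) (Y p) (Z p) hε₀ hε₁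
  have b1 := hS.covΦTensor_φ_left_right (Z p) (X p) (W p) hε₀ hε₁
  have b2 := hS.covΦTensor_φ_left_right (Z p) (X p) (Y p) hε₀ hε₁
  have b3 := hS.covΦTensor_φ_left_right (Z p) (Y p) (W p) hε₀ hε₁
  have b4 := S.covΦTensor_skew (S.φ p (Z p)) (S.φ p (Y p)) (X p) hε₁
  have c1 := S.covΦTensor_skew (X p) (Y p) (S.covφ p (W p) (Z p)) hε₁
  have c2 := S.covΦTensor_skew (S.φ p (X p)) (Y p) (S.covφ p (W p) (S.φ p (Z p))) hε₁
  have d1 := hS.covη_sub_swap (S.φ p (Y p)) (S.covφ p (X p) (Z p)) hε₀ hε₁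
  have d2 := S.Φ_skew hε₁ (S.covφ p (Y p) (S.φ p (Z p))) (X p)
  have d3 := S.Φ_φ_right hε₁ (S.covφ p (X p) (Z p)) (Y p)
  have d4 := S.Φ_skew hε₁ (S.φ p (Y p)) (S.covφ p (X p) (Z p))
  have d5 := S.Φ_φ_right hε₁ (S.covφ p (X p) (Z p)) (W p)
  rw [S.η_covφ _ _ hε₀ hε₁] at d3 d5
  -- `f1` and `f2` display the two quadratic terms as inner products of values of ∇φ, which `a2`
  -- compares.
  have f1 : S.covΦTensor p (X p) (S.covφ p (W p) (Z p)) (Y p) =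
    S.g.inner p (S.covφ p (Y p) (X p)) (S.covφ p (W p) (Z p)) := S.g.symm ..
  have f2 : S.covΦTensor p (S.φ p (X p)) (S.covφ p (W p) (S.φ p (Z p))) (Y p) =
    S.g.inner p (S.covφ p (Y p) (S.φ p (X p))) (S.covφ p (W p) (S.φ p (Z p))) := S.g.symm ..
  have f3 : S.g.inner p (S.covφ p (X p) (Z p)) (Y p) = S.covΦTensor p (Z p) (Y p) (X p) :=
    S.g.symm ..
  have f4 : S.g.inner p (S.covφ p (X p) (Z p)) (W p) = S.covΦTensor p (Z p) (W p) (X p) :=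
    S.g.symm ..
  simp only [φField] at *
  linear_combination (norm := skip) -e1 + ε₁ * e2 + ε₀ * S.η p (W p) * (e3 + e4 + ε₁ * e5 + e6
    + 2 * d2 - 2 * a4 - a5 + 2 * b4 - 2 * b2) - ε₁ * a1 - c1 + f1 + ε₁ * (-c2 + f2 + a2)
    + 2 * ε₀ * S.η p (Y p) * (b1 + a3) - 2 * ε₀ * S.η p (X p) * b3
    + 2 * ε₀ * S.η p (Y p) * (d5 + ε₁ * f4)
    + ε₀ * S.η p (W p) * (d1 + 2 * d4 - 2 * d3 - 2 * ε₁ * f3)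
  rcases eq_one_or_eq_neg_one_of_sq hε₀ with rfl | rfl <;>
    rcases eq_one_or_eq_neg_one_of_sq hε₁ with rfl | rfl <;> ring

end IsParaContact

end AlmostParaContactMetricStructure

/-! ### The curvature identity -/

theorem mainTheorem2 {n : ℕ}
    {E : Type*} [NormedAddCommGroup E] [NormedSpace ℝ E] [FiniteDimensional ℝ E]
    (hE : Module.finrank ℝ E = 2 * n + 1)
    {M : Type*} [TopologicalSpace M] [ChartedSpace E M] [IsManifold 𝓘(ℝ, E) ∞ M]
    {ε₀ ε₁ : ℝ} (hε₀ : ε₀ = 1 ∨ ε₀ = -1) (hε₁ : ε₁ = 1 ∨ ε₁ = -1)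
    (S : AlmostParaContactMetricStructure ε₀ ε₁ E M) (hS : S.IsParaContact) (p : M)
    (X Y Z W : Π x : M, TangentSpace 𝓘(ℝ, E) x)
    (hX : ContMDiffAt 𝓘(ℝ, E) (𝓘(ℝ, E).prod 𝓘(ℝ, E)) ∞ (fun x ↦ TotalSpace.mk' E x (X x)) p)
    (hY : ContMDiffAt 𝓘(ℝ, E) (𝓘(ℝ, E).prod 𝓘(ℝ, E)) ∞ (fun x ↦ TotalSpace.mk' E x (Y x)) p)
    (hZ : ContMDiffAt 𝓘(ℝ, E) (𝓘(ℝ, E).prod 𝓘(ℝ, E)) ∞ (fun x ↦ TotalSpace.mk' E x (Z x)) p)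
    (hW : ContMDiffAt 𝓘(ℝ, E) (𝓘(ℝ, E).prod 𝓘(ℝ, E)) ∞ (fun x ↦ TotalSpace.mk' E x (W x)) p)
    (e : Fin (2 * n + 1) → TangentSpace 𝓘(ℝ, E) p)
    (he_orthogonal : ∀ i j, i ≠ j → S.g.inner p (e i) (e j) = 0)
    (he_unit : ∀ i, S.g.inner p (e i) (e i) = 1 ∨ S.g.inner p (e i) (e i) = -1) :
    S.g.riemann Z (S.φField X) (S.φField Y) W p
      + S.g.riemann Z (S.φField X) Y (S.φField W) p
      + S.g.riemann (S.φField Z) X (S.φField Y) W p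
      + S.g.riemann (S.φField Z) X Y (S.φField W) p
      - S.g.riemann (S.φField Z) (S.φField X) Y W p
      - ε₁ * S.g.riemann (S.φField Z) (S.φField X) (S.φField Y) (S.φField W) p
      - ε₁ * S.g.riemann Z X Y W p
      - S.g.riemann Z X (S.φField Y) (S.φField W) p
    = -2 * ∑ i, S.g.inner p (e i) (e i) * S.covΦ p (e i) Z X * S.covΦ p (e i) W Y
      + 2 * ε₀ * ε₁ * S.covΦ p (Z p) W Y * S.η p (X p)
      - 2 * ε₀ * ε₁ * S.covΦ p (X p) W Y * S.η p (Z p)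
      - 2 * ε₀ * ε₁ * S.covΦ p (Y p) Z X * S.η p (W p)
      + 2 * ε₀ * ε₁ * S.covΦ p (W p) Z X * S.η p (Y p)
      + 4 * ε₀ * S.g.inner p (S.φ p (X p)) (S.φ p (Y p))
          * S.g.inner p (S.φ p (Z p)) (S.φ p (W p))
      - 4 * ε₀ * S.g.inner p (S.φ p (Z p)) (S.φ p (Y p))
          * S.g.inner p (S.φ p (X p)) (S.φ p (W p))
      + 4 * ε₀ * ε₁ * S.g.inner p (Y p) (S.φ p (X p)) * S.g.inner p (S.φ p (Z p)) (W p)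
      - 4 * ε₀ * ε₁ * S.g.inner p (Y p) (S.φ p (Z p)) * S.g.inner p (S.φ p (X p)) (W p) := by
  have hε₀' : ε₀ ^ 2 = 1 := by rcases hε₀ with h | h <;> rw [h] <;> norm_num
  have hε₁' : ε₁ ^ 2 = 1 := by rcases hε₁ with h | h <;> rw [h] <;> norm_num
  replace hX : CMDiffAt 2 (T% X) p := hX.of_le (by norm_cast)
  replace hY : CMDiffAt 2 (T% Y) p := hY.of_le (by norm_cast)
  replace hZ : CMDiffAt 2 (T% Z) p := hZ.of_le (by norm_cast)
  replace hW : CMDiffAt 2 (T% W) p := hW.of_le (by norm_cast)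
  have md {X : Π x : M, TangentSpace 𝓘(ℝ, E) x} (hX : CMDiffAt 2 (T% X) p) :
    MDiffAt (T% X) p := hX.mdifferentiableAt (by norm_num)
  have hφX := S.contMDiffAt_φField hX
  have hφY := S.contMDiffAt_φField hY
  have hφZ := S.contMDiffAt_φField hZ
  have hφW := S.contMDiffAt_φField hW
  have hξ := S.contMDiffAt_ξ p
  -- The eight curvature terms pair off as `A1 + A2 - ε₁ * A3 - A4`. The `B`'s then exchange Y and W
  -- in ∇²φ to match `half_curvature`, and the `C`'s turn R(·,·,Y,ξ) into ∇²η.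
  have A1 := S.riemann_φ_add (W := W) hε₁' hZ hφX hY
  have A2 := S.riemann_φ_add (W := W) hε₁' hφZ hX hY
  have A3 := S.riemann_φ_φ_add (W := W) hε₁' hφZ hφX hY
  have A4 := S.riemann_φ_φ_add (W := W) hε₁' hZ hX hY
  have B1 := S.inner_covcovφ_skew hε₁' (Z p) hφX hW hY
  have B2 := S.inner_covcovφ_skew hε₁' (S.φ p (X p)) hZ hW hY
  have B3 := S.inner_covcovφ_skew hε₁' (S.φ p (Z p)) hX hW hY
  have B4 := S.inner_covcovφ_skew hε₁' (X p) hφZ hW hY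
  have B5 := S.inner_covcovφ_skew hε₁' (S.φ p (Z p)) hφX hφW hY
  have B6 := S.inner_covcovφ_skew hε₁' (S.φ p (X p)) hφZ hφW hY
  have B7 := S.inner_covcovφ_skew hε₁' (Z p) hX hφW hY
  have B8 := S.inner_covcovφ_skew hε₁' (X p) hZ hφW hY
  have C1 := S.g.riemann_skew hφZ hφX hY hξ
  have C2 := S.g.riemann_skew hZ hX hY hξ
  have C3 := S.covcovη_sub_swap (X := Y) (md hφZ) (md hφX)
  have C4 := S.covcovη_sub_swap (X := Y) (md hZ) (md hX)
  have G1 := hS.half_curvature (Z := Z) hε₀' hε₁' hX hY hW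
  have G2 := hS.half_curvature (Z := X) hε₀' hε₁' hZ hY hW
  simp only [AlmostParaContactMetricStructure.φField] at B1 B2 B3 B4 B5 B6 B7 B8 C3 A1 A2 A3 G1 G2
  -- By closedness, (∇_vΦ)(Z,X) is the inner product of v with (∇_Zφ)X - (∇_Xφ)Z, so the frame sum
  -- is a single inner product.
  have hsum : ∑ i, S.g.inner p (e i) (e i) * S.covΦ p (e i) Z X * S.covΦ p (e i) W Y =
      S.g.inner p (S.covφ p (X p) (Z p) - S.covφ p (Z p) (X p))
        (S.covφ p (Y p) (W p) - S.covφ p (W p) (Y p)) := by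
    have key {Z X : Π x : M, TangentSpace 𝓘(ℝ, E) x} (hZ : CMDiffAt 2 (T% Z) p)
        (hX : CMDiffAt 2 (T% X) p) (i : Fin (2 * n + 1)) : S.covΦ p (e i) Z X =
        S.g.inner p (S.covφ p (X p) (Z p) - S.covφ p (Z p) (X p)) (e i) := by
      have h1 := hS.covΦTensor_cyclic (e i) (Z p) (X p) hε₀' hε₁'
      have h2 := S.covΦTensor_skew (Z p) (X p) (e i) hε₁'
      rw [S.covΦ_eq (md hZ) (md hX), S.g.symm, map_sub]
      simp only [AlmostParaContactMetricStructure.covΦTensor] at h1 h2 ⊢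
      linarith
    rw [← S.g.sum_inner_mul_inner e (by simp [hE]) he_orthogonal he_unit]
    exact Finset.sum_congr rfl fun i _ ↦ by rw [key hZ hX, key hW hY]
  have hT (v : TangentSpace 𝓘(ℝ, E) p) :
      S.g.inner p v (S.covφ p (Y p) (W p) - S.covφ p (W p) (Y p)) =
        -S.covΦTensor p v (Y p) (W p) := by
    have h1 := hS.covΦTensor_cyclic v (Y p) (W p) hε₀' hε₁'
    have h2 := S.covΦTensor_skew (Y p) (W p) v hε₁'
    rw [map_sub]
    simp only [AlmostParaContactMetricStructure.covΦTensor] at h1 h2 ⊢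
    linarith
  rw [hsum, hT]
  have hT' : S.covΦTensor p (S.covφ p (X p) (Z p) - S.covφ p (Z p) (X p)) (Y p) (W p) =
      S.covΦTensor p (S.covφ p (X p) (Z p)) (Y p) (W p)
        - S.covΦTensor p (S.covφ p (Z p) (X p)) (Y p) (W p) := by
    simp only [AlmostParaContactMetricStructure.covΦTensor, map_sub]
  rw [hT', S.covΦ_eq (md hW) (md hY), S.covΦ_eq (md hW) (md hY), S.covΦ_eq (md hZ) (md hX),
    S.covΦ_eq (md hZ) (md hX), S.inner_φ_φ, S.inner_φ_φ, S.inner_φ_φ, S.inner_φ_φ,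
    S.g.symm p (S.φ p (Z p)) (W p), S.g.symm p (S.φ p (X p)) (W p), ← S.Φ_eq, ← S.Φ_eq, ← S.Φ_eq,
    ← S.Φ_eq]
  -- `hN`, `n1` and `n2` serve as rewriting rules that bring the ∇η terms to a common form before
  -- `ring`.
  have hN (a b : TangentSpace 𝓘(ℝ, E) p) : S.covη p (S.φ p a) b =
      S.covη p a (S.φ p b) - 2 * (ε₁ * (S.g.inner p a b - ε₀ * S.η p a * S.η p b)) := by
    have h1 := hS.covη_sub_swap a (S.φ p b) hε₀' hε₁'
    rw [S.Φ_φ_right hε₁'] at h1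
    linear_combination hS.covη_φ_left a b hε₀' hε₁' - h1
  have n1 := hS.covη_sub_swap (X p) (Y p) hε₀' hε₁'
  have n2 := hS.covη_sub_swap (Z p) (Y p) hε₀' hε₁'
  -- Closedness again: it trades the derivatives of Φ along Z and X for the one along `b`, used with
  -- `b` equal to Y and W.
  have hC (b : TangentSpace 𝓘(ℝ, E) p) : S.covΦTensor p (Z p) b (X p)
      - S.covΦTensor p b (Z p) (X p) - S.covΦTensor p (X p) b (Z p) = 0 := by
    linear_combination S.covΦTensor_skew (Z p) b (X p) hε₁'
      - hS.covΦTensor_cyclic (X p) b (Z p) hε₀' hε₁'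
  rw [sub_eq_iff_eq_add'] at n1 n2
  linear_combination (norm := skip) A1 + A2 - ε₁ * A3 - A4 + B1 - B2 + B3 - B4 - ε₁ * (B5 - B6)
    - (B7 - B8) - S.η p (W p) * (C1 + ε₁ * C2) - ε₀ * S.η p (W p) * (C3 + ε₁ * C4) + G1 - G2
    - 2 * ε₀ * ε₁ * (S.η p (W p) * hC (Y p) - S.η p (Y p) * hC (W p)
      + S.η p (X p) * S.covΦTensor_skew (Z p) (Y p) (W p) hε₁'
      - S.η p (Z p) * S.covΦTensor_skew (X p) (Y p) (W p) hε₁')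
  simp only [hN, S.Φ_φ_right hε₁', n1, n2, S.Φ_skew hε₁' (Y p), S.Φ_skew hε₁' (W p),
    S.g.symm p (X p) (Z p)]
  rcases hε₀ with rfl | rfl <;> rcases hε₁ with rfl | rfl <;> ring

end
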